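/- Let $\Bbbk$ be a commutative ring. A (right) pre-Lie algebra is a $\Bbbk$-module $L$ with a bilinear product $\circ$ such that $(X\circ Y)\circ Z-X\circ(Y\circ Z)$ is symmetric in $Y$ and $Z$. Let $S(L)$ be its symmetric algebra, with the coproduct $\Delta(A)=A_{(1)}\otimes A_{(2)}$ for which $\Delta$ is an algebra morphism and the elements of $L$ are primitive. The product of $L$ extends uniquely to a bilinear product $\circ$ on $S(L)$ such that $A\circ 1=A$, $T\circ(BX)=(T\circ B)\circ X-T\circ(B\circ X)$ and $(AB)\circ C=(A\circ C_{(1)})(B\circ C_{(2)})$ for $A,B,C\in S(L)$ and $T,X\in L$; one sets $A*B:=(A\circ B_{(1)})\,B_{(2)}$. Let $\mathcal{PL}$ be the pre-Lie algebra of rooted trees: the free $\Bbbk$-module on the isomorphism classes of finite rooted trees, with $T\circ S=\sum_{v}T\circ_v S$, the sum being over the vertices $v$ of $T$, where $T\circ_v S$ is obtained by joining the root of $S$ to $v$ by a new edge. The monomials of $S(\mathcal{PL})$ are the forests (finite multisets of rooted trees). Let $\mathcal B_+:S(\mathcal{PL})\to S(\mathcal{PL})$ be the linear map that sends a forest to the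 tree obtained by joining the roots of its trees to a new root. The Connes–Kreimer coproduct $\Delta_{CK}:S(\mathcal{PL})\to S(\mathcal{PL})\otimes S(\mathcal{PL})$ is the unique algebra morphism such that $\Delta_{CK}\circ\mathcal B_+=\mathcal B_+\otimes 1+(\mathrm{id}\otimes\mathcal B_+)\circ\Delta_{CK}$; let $\Delta_{CK}^{op}=\tau\circ\Delta_{CK}$, where $\tau$ is the flip. Finally, let $\langle\cdot,\cdot\rangle$ be the bilinear form on $S(\mathcal{PL})$ given on forests by $\langle F,G\rangle=|\mathrm{Aut}\,F|$ if $F=G$ and $\langle F,G\rangle=0$ otherwise, and put $\langle A\otimes B,C\otimes D\rangle=\langle A,C\rangle\langle B,D\rangle$. **Proposition.** The product $*$ on $S(\mathcal{PL})$ is exactly the dual of the opposite of the Connes–Kreimer coproduct: for all $A,B,C\in S(\mathcal{PL})$, $$\langle A*B,\;C\rangle=\langle A\otimes B,\;\Delta_{CK}^{op}(C)\rangle .$$ Moreover $\langle A,BC\rangle=\langle\Delta(A),B\otimes C\rangle$ for all $A,B,C$, so that $(S(\mathcal{PL}),*,\Delta)$ is dual to $S(\mathcal{PL})$ with its polynomial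 product and $\Delta_{CK}^{op}$. The pairing is nondegenerate on both sides whenever the additive group of $\Bbbk$ is torsion free. If every nonzero integer is invertible in $\Bbbk$, then a linear form $\varphi$ on $S(\mathcal{PL})$ vanishes on all forests with sufficiently many vertices if and only if $\varphi=\langle A,\cdot\rangle$ for exactly one $A\in S(\mathcal{PL})$; that is, $A\mapsto\langle A,\cdot\rangle$ is an isomorphism of $S(\mathcal{PL})$ onto its graded dual. -/

import Mathlib

open scoped TensorProduct

noncomputable section

namespace PreLieSym

section General

variable (k : Type*) [CommRing k]

section Module

variable (M : Type*) [AddCommGroup M] [Module k M]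

/-- The (unshuffle) coproduct of the symmetric algebra: the algebra morphism for which the
elements of `M` are primitive. -/
def coproduct : SymmetricAlgebra k M →ₐ[k] SymmetricAlgebra k M ⊗[k] SymmetricAlgebra k M :=
  SymmetricAlgebra.lift
    ((TensorProduct.mk k (SymmetricAlgebra k M) (SymmetricAlgebra k M)).flip 1 ∘ₗ
        SymmetricAlgebra.ι k M +
      TensorProduct.mk k (SymmetricAlgebra k M) (SymmetricAlgebra k M) 1 ∘ₗ
        SymmetricAlgebra.ι k M)

variable {M}

theorem coproduct_ι (x : M) : coproduct k M (SymmetricAlgebra.ι k M x) =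
    SymmetricAlgebra.ι k M x ⊗ₜ[k] 1 + 1 ⊗ₜ[k] SymmetricAlgebra.ι k M x := by
  simp [coproduct]

theorem sym_induction {p : SymmetricAlgebra k M → Prop} (one : p 1)
    (add : ∀ a b, p a → p b → p (a + b)) (smul : ∀ (r : k) a, p a → p (r • a))
    (mul_ι : ∀ a x, p a → p (a * SymmetricAlgebra.ι k M x)) (a : SymmetricAlgebra k M) : p a := by
  suffices h : ∀ b, p b → p (b * a) by simpa using h 1 one
  induction a using SymmetricAlgebra.induction with
  | algebraMap r =>
    intro b hb
    rw [mul_comm, ← Algebra.smul_def]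
    exact smul r b hb
  | ι x => exact fun b hb => mul_ι b x hb
  | mul a c ha hc => exact fun b hb => by rw [← mul_assoc]; exact hc _ (ha b hb)
  | add a c ha hc => exact fun b hb => by rw [mul_add]; exact add _ _ (ha b hb) (hc b hb)

theorem exists_linear_rec {N : Type*} [AddCommGroup N] [Module k N]
    (G : SymmetricAlgebra k M →ₗ[k] M →ₗ[k] N)
    (hG : ∀ a x y, G (a * SymmetricAlgebra.ι k M x) y = G (a * SymmetricAlgebra.ι k M y) x)
    (n₀ : N) :
    ∃ F : SymmetricAlgebra k M →ₗ[k] N, F 1 = n₀ ∧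
      ∀ a x, F (a * SymmetricAlgebra.ι k M x) = G a x := by
  let P : M →ₗ[k] Module.End k (SymmetricAlgebra k M × N) :=
    LinearMap.mk₂ k (fun x q => (q.1 * SymmetricAlgebra.ι k M x, G q.1 x))
      (by intros; simp [mul_add]) (by intros; simp) (by intros; simp [add_mul])
      (by intros; simp)
  have hP : ∀ x q, P x q = (q.1 * SymmetricAlgebra.ι k M x, G q.1 x) := fun _ _ => rfl
  have hcomm : ∀ a ∈ Set.range P, ∀ b ∈ Set.range P, a * b = b * a := by
    rintro _ ⟨x, rfl⟩ _ ⟨y, rfl⟩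
    refine LinearMap.ext fun q => ?_
    simp only [Module.End.mul_apply, hP, hG q.1 x y]
    rw [mul_right_comm]
  have hc := Algebra.isMulCommutative_adjoin k hcomm
  let _ : CommSemiring (Algebra.adjoin k (Set.range P)) :=
    { (inferInstance : Semiring (Algebra.adjoin k (Set.range P))) with
      mul_comm := hc.is_comm.comm }
  let P' : M →ₗ[k] Algebra.adjoin k (Set.range P) :=
    LinearMap.codRestrict (Subalgebra.toSubmodule (Algebra.adjoin k (Set.range P))) P
      fun x => Algebra.subset_adjoin ⟨x, rfl⟩
  let φ : SymmetricAlgebra k M →ₐ[k] Algebra.adjoin k (Set.range P) := SymmetricAlgebra.lift P'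
  have hφ : ∀ x, ((φ (SymmetricAlgebra.ι k M x) : Algebra.adjoin k (Set.range P)) :
      Module.End k (SymmetricAlgebra k M × N)) = P x := fun x =>
    congrArg Subtype.val (SymmetricAlgebra.lift_ι_apply P' x)
  let Φ : SymmetricAlgebra k M →ₗ[k] SymmetricAlgebra k M × N :=
    (LinearMap.applyₗ ((1 : SymmetricAlgebra k M), n₀)) ∘ₗ (Algebra.adjoin k (Set.range P)).val.toLinearMap ∘ₗ
      φ.toLinearMap
  have h1 : Φ 1 = (1, n₀) := by simp [Φ]
  have hmul : ∀ a x, Φ (a * SymmetricAlgebra.ι k M x) = P x (Φ a) := by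
    intro a x
    rw [mul_comm]
    simp [Φ, hφ]
  have hfst : ∀ a, (Φ a).1 = a := by
    intro a
    induction a using sym_induction with
    | one => simp [h1]
    | add a b ha hb => simp [ha, hb]
    | smul r a ha => simp [ha]
    | mul_ι a x ha => simp [hmul, hP, ha]
  exact ⟨LinearMap.snd k (SymmetricAlgebra k M) N ∘ₗ Φ, by simp [h1], fun a x => by simp [hmul, hP, hfst]⟩

/-- The submodule of homogeneous elements of length `m`. -/
def lengthPart (m : ℕ) : Submodule k (SymmetricAlgebra k M) :=
  LinearMap.range (SymmetricAlgebra.ι k M) ^ m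

theorem lengthPart_induction {m : ℕ} {p : SymmetricAlgebra k M → Prop}
    (add : ∀ a b, p a → p b → p (a + b))
    (mul_ι : ∀ a ∈ lengthPart k (M := M) m, ∀ x, p (a * SymmetricAlgebra.ι k M x))
    {a : SymmetricAlgebra k M} (ha : a ∈ lengthPart k (M := M) (m + 1)) : p a := by
  rw [lengthPart, pow_succ] at ha
  refine Submodule.mul_induction_on ha ?_ add
  rintro b hb _ ⟨x, rfl⟩
  exact mul_ι b hb x

theorem mul_ι_mem {m : ℕ} {a : SymmetricAlgebra k M} (ha : a ∈ lengthPart k (M := M) m) (x : M) :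
    a * SymmetricAlgebra.ι k M x ∈ lengthPart k (M := M) (m + 1) := by
  rw [lengthPart, pow_succ]
  exact Submodule.mul_mem_mul ha ⟨x, rfl⟩

theorem length_induction {p : SymmetricAlgebra k M → Prop}
    (add : ∀ a b, p a → p b → p (a + b))
    (h : ∀ m, ∀ a ∈ lengthPart k (M := M) m, p a) (a : SymmetricAlgebra k M) : p a := by
  have : a ∈ ⨆ m, lengthPart k (M := M) m := by
    induction a using sym_induction with
    | one => exact Submodule.mem_iSup_of_mem 0 (by simp [lengthPart])
    | add a b ha hb => exact add_mem ha hb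
    | smul r a ha => exact Submodule.smul_mem _ _ ha
    | mul_ι a x ha =>
      induction ha using Submodule.iSup_induction' with
      | mem i y hy => exact Submodule.mem_iSup_of_mem (i + 1) (mul_ι_mem k hy x)
      | zero => simp
      | add y z _ _ hy hz => rw [add_mul]; exact add_mem hy hz
  induction this using Submodule.iSup_induction' with
  | mem i y hy => exact h i y hy
  | zero => exact h 0 0 (zero_mem _)
  | add y z _ _ hy hz => exact add _ _ hy hz

end Module

variable (L : Type*) [RightPreLieRing L] [RightPreLieAlgebra k L]

/-- `IsExtension k L c` says that the bilinear map `c` extends the product of the right pre-Lie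
algebra `L` (written `x * y` here) to its symmetric algebra, in such a way that, `∘` denoting `c`,
`A ∘ 1 = A`, `T ∘ (B X) = (T ∘ B) ∘ X - T ∘ (B ∘ X)` and `(A B) ∘ C = (A ∘ C₍₁₎) (B ∘ C₍₂₎)` for
all `A, B, C` in the symmetric algebra and `T, X` in `L`. -/
structure IsExtension (c : SymmetricAlgebra k L →ₗ[k] SymmetricAlgebra k L →ₗ[k]
    SymmetricAlgebra k L) : Prop where
  extends_mul : ∀ x y : L, c (SymmetricAlgebra.ι k L x) (SymmetricAlgebra.ι k L y) =
    SymmetricAlgebra.ι k L (x * y)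
  one_right : ∀ A, c A 1 = A
  ι_mul : ∀ (T : L) (B : SymmetricAlgebra k L) (X : L),
    c (SymmetricAlgebra.ι k L T) (B * SymmetricAlgebra.ι k L X) =
      c (c (SymmetricAlgebra.ι k L T) B) (SymmetricAlgebra.ι k L X) -
        c (SymmetricAlgebra.ι k L T) (c B (SymmetricAlgebra.ι k L X))
  mul_left : ∀ A B C, c (A * B) C =
    LinearMap.mul' k (SymmetricAlgebra k L)
      (TensorProduct.map (c A) (c B) (coproduct k L C))

theorem exists_der : ∃ D : L →ₗ[k] SymmetricAlgebra k L →ₗ[k] SymmetricAlgebra k L,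
    (∀ x, D x 1 = 0) ∧
    (∀ x y, D x (SymmetricAlgebra.ι k L y) = SymmetricAlgebra.ι k L (y * x)) ∧
    (∀ x a b, D x (a * b) = D x a * b + a * D x b) := by
  let f : L → L →ₗ[k] DualNumber (SymmetricAlgebra k L) := fun x =>
    (TrivSqZeroExt.inlAlgHom k (SymmetricAlgebra k L) (SymmetricAlgebra k L)).toLinearMap ∘ₗ SymmetricAlgebra.ι k L +
      (TrivSqZeroExt.inrHom (SymmetricAlgebra k L) (SymmetricAlgebra k L)).restrictScalars k ∘ₗ SymmetricAlgebra.ι k L ∘ₗ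
        LinearMap.mulRight k x
  let φ : L → SymmetricAlgebra k L →ₐ[k] DualNumber (SymmetricAlgebra k L) := fun x => SymmetricAlgebra.lift (f x)
  have hφ : ∀ x y, φ x (SymmetricAlgebra.ι k L y) = f x y :=
    fun x y => SymmetricAlgebra.lift_ι_apply (f x) y
  have hfst : ∀ x a, (φ x a).fst = a := by
    intro x a
    induction a using SymmetricAlgebra.induction with
    | algebraMap r => simp [TrivSqZeroExt.algebraMap_eq_inl']
    | ι y => rw [hφ]; simp [f]
    | mul a b ha hb => simp [ha, hb]
    | add a b ha hb => simp [ha, hb]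
  have hι : ∀ x y, (φ x (SymmetricAlgebra.ι k L y)).snd = SymmetricAlgebra.ι k L (y * x) := by
    intro x y
    rw [hφ]; simp [f]
  have h0 : ∀ x r, (φ x (algebraMap k (SymmetricAlgebra k L) r)).snd = 0 := by
    intro x r
    simp [TrivSqZeroExt.algebraMap_eq_inl']
  have hmul : ∀ x a b, (φ x (a * b)).snd = (φ x a).snd * b + a * (φ x b).snd := by
    intro x a b
    simp [hfst]
    ring
  refine ⟨LinearMap.mk₂ k (fun x a => (φ x a).snd) ?_ ?_ ?_ ?_, ?_, ?_, ?_⟩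
  · intro x y a
    induction a using SymmetricAlgebra.induction with
    | algebraMap r => simp only [h0, add_zero]
    | ι z => simp only [hι, mul_add, map_add]
    | mul a b ha hb => rw [hmul, hmul, hmul, ha, hb]; ring
    | add a b ha hb => simp only [map_add, TrivSqZeroExt.snd_add, ha, hb]; abel
  · intro r x a
    induction a using SymmetricAlgebra.induction with
    | algebraMap r => simp only [h0, smul_zero]
    | ι z => simp only [hι, mul_smul_comm, map_smul]
    | mul a b ha hb =>
      rw [hmul, hmul, ha, hb, smul_add, smul_mul_assoc, mul_smul_comm]
    | add a b ha hb => simp only [map_add, TrivSqZeroExt.snd_add, ha, hb, smul_add]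
  · intro x a b; simp
  · intro r x a; simp
  · intro x; simp
  · intro x y; exact hι x y
  · intro x a b; exact hmul x a b

theorem coproduct_der (D : SymmetricAlgebra k L →ₗ[k] SymmetricAlgebra k L) (d : L → L)
    (h1 : D 1 = 0) (hι : ∀ y, D (SymmetricAlgebra.ι k L y) = SymmetricAlgebra.ι k L (d y))
    (hmul : ∀ a b, D (a * b) = D a * b + a * D b) (a : SymmetricAlgebra k L) :
    coproduct k L (D a) =
      (D.rTensor (SymmetricAlgebra k L) + D.lTensor (SymmetricAlgebra k L)) (coproduct k L a) := by
  induction a using sym_induction with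
  | one => simp [h1, Algebra.TensorProduct.one_def]
  | add a b ha hb => simp only [map_add, ha, hb]
  | smul r a ha => simp only [map_smul, ha]
  | mul_ι a x ha =>
    rw [hmul, hι, map_add, map_mul, map_mul, map_mul, ha, coproduct_ι, coproduct_ι]
    generalize coproduct k L a = t
    induction t using TensorProduct.induction_on with
    | zero => simp
    | add s t hs ht =>
      simp only [map_add, add_mul] at hs ht ⊢
      rw [← sub_eq_zero] at hs ht ⊢
      rw [← add_zero (0 : SymmetricAlgebra k L ⊗[k] SymmetricAlgebra k L)]
      nth_rw 2 [← hs]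
      rw [← ht]
      abel
    | tmul u v =>
      simp only [LinearMap.add_apply, LinearMap.rTensor_tmul, LinearMap.lTensor_tmul, mul_add,
        add_mul, Algebra.TensorProduct.tmul_mul_tmul, mul_one, map_add, hmul, hι,
        TensorProduct.add_tmul, TensorProduct.tmul_add]
      abel

theorem exists_Φ (D : L →ₗ[k] SymmetricAlgebra k L →ₗ[k] SymmetricAlgebra k L)
    (h1 : ∀ x, D x 1 = 0)
    (hι : ∀ x y, D x (SymmetricAlgebra.ι k L y) = SymmetricAlgebra.ι k L (y * x))
    (hmul : ∀ x a b, D x (a * b) = D x a * b + a * D x b) :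
    ∃ F : SymmetricAlgebra k L →ₗ[k] SymmetricAlgebra k L →ₗ[k] SymmetricAlgebra k L,
      F 1 = LinearMap.id ∧
      ∀ B X, F (B * SymmetricAlgebra.ι k L X) = D X ∘ₗ F B - F (D X B) := by
  -- the right action of `L` on the symmetric algebra is right symmetric
  have hsymm : ∀ x y a, D y (D x a) + D (y * x) a = D x (D y a) + D (x * y) a := by
    intro x y a
    induction a using sym_induction with
    | one => simp [h1]
    | add a b ha hb =>
      simp only [map_add]
      rw [add_add_add_comm, ha, hb]
      abel
    | smul r a ha => simp only [map_smul, ← smul_add, ha]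
    | mul_ι a z ha =>
      simp only [hmul, hι, map_add]
      have hz : SymmetricAlgebra.ι k L (z * x * y) + SymmetricAlgebra.ι k L (z * (y * x)) =
          SymmetricAlgebra.ι k L (z * y * x) + SymmetricAlgebra.ι k L (z * (x * y)) := by
        rw [← map_add, ← map_add]
        congr 1
        have := RightPreLieRing.assoc_symm z x y
        rw [associator_apply, associator_apply, sub_eq_sub_iff_add_eq_add] at this
        exact this
      linear_combination (SymmetricAlgebra.ι k L z) * ha + a * hz
  let G : (SymmetricAlgebra k L →ₗ[k] (SymmetricAlgebra k L →ₗ[k] SymmetricAlgebra k L)) → SymmetricAlgebra k L →ₗ[k] L →ₗ[k] (SymmetricAlgebra k L →ₗ[k] SymmetricAlgebra k L) := fun F =>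
    LinearMap.mk₂ k (fun B X => D X ∘ₗ F B - F (D X B))
      (by intro a b x; simp only [map_add, LinearMap.comp_add]; abel)
      (by intro r b x; simp only [map_smul, LinearMap.comp_smul, smul_sub])
      (by intro a x y; simp only [map_add, LinearMap.add_apply, LinearMap.add_comp]; abel)
      (by intro r a x; simp only [map_smul, LinearMap.smul_apply, LinearMap.smul_comp, smul_sub])
  have hG : ∀ F B X, G F B X = D X ∘ₗ F B - F (D X B) := fun _ _ _ => rfl
  let Good : (SymmetricAlgebra k L →ₗ[k] (SymmetricAlgebra k L →ₗ[k] SymmetricAlgebra k L)) → Prop := fun F => ∀ a x y,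
    G F (a * SymmetricAlgebra.ι k L x) y = G F (a * SymmetricAlgebra.ι k L y) x
  have hstep : ∀ F F' : SymmetricAlgebra k L →ₗ[k] (SymmetricAlgebra k L →ₗ[k] SymmetricAlgebra k L),
      (∀ a x, F' (a * SymmetricAlgebra.ι k L x) = G F a x) → Good F' := by
    intro F F' hF a x y
    simp only [hG, hmul, hι, map_add, hF]
    have h2 := congrArg F (hsymm x y a)
    ext b
    have h3 := hsymm x y (F a b)
    have h4 := LinearMap.congr_fun h2 b
    simp only [map_add, LinearMap.add_apply] at h4
    simp only [LinearMap.sub_apply, LinearMap.add_apply, LinearMap.comp_apply, map_sub]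
    linear_combination h3 - h4
  let F₀ : SymmetricAlgebra k L →ₗ[k] (SymmetricAlgebra k L →ₗ[k] SymmetricAlgebra k L) :=
    (SymmetricAlgebra.algebraMapInv (R := k) (M := L)).toLinearMap.smulRight LinearMap.id
  have hF₀ : ∀ a x, F₀ (a * SymmetricAlgebra.ι k L x) = 0 := by
    intro a x
    simp [F₀, SymmetricAlgebra.algebraMapInv_ι]
  have hF₀D : ∀ x a, F₀ (D x a) = 0 := by
    intro x a
    induction a using sym_induction with
    | one => simp [h1]
    | add a b ha hb => simp only [map_add, ha, hb, add_zero]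
    | smul r a ha => simp only [map_smul, ha, smul_zero]
    | mul_ι a z ha =>
      rw [hmul, hι, map_add, hF₀, hF₀, add_zero]
  have hgood₀ : Good F₀ := by
    intro a x y
    simp only [hG, hF₀, hF₀D, LinearMap.comp_zero]
  let seq : ℕ → {F : SymmetricAlgebra k L →ₗ[k] (SymmetricAlgebra k L →ₗ[k] SymmetricAlgebra k L) // Good F} := fun n =>
    Nat.rec ⟨F₀, hgood₀⟩ (fun _ F =>
      ⟨Classical.choose (exists_linear_rec k (G F.1) F.2 0),
        hstep F.1 _ (Classical.choose_spec (exists_linear_rec k (G F.1) F.2 0)).2⟩) n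
  let Φ : ℕ → SymmetricAlgebra k L →ₗ[k] (SymmetricAlgebra k L →ₗ[k] SymmetricAlgebra k L) := fun n => (seq n).1
  have hΦ0 : Φ 0 = F₀ := rfl
  have hΦ1 : ∀ n, Φ (n + 1) 1 = 0 := fun n =>
    (Classical.choose_spec (exists_linear_rec k (G (seq n).1) (seq n).2 0)).1
  have hΦs : ∀ n a x, Φ (n + 1) (a * SymmetricAlgebra.ι k L x) =
      D x ∘ₗ Φ n a - Φ n (D x a) := fun n =>
    (Classical.choose_spec (exists_linear_rec k (G (seq n).1) (seq n).2 0)).2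
  clear_value Φ
  have hDmem : ∀ m x, ∀ a ∈ lengthPart k (M := L) m, D x a ∈ lengthPart k (M := L) m := by
    intro m x
    induction m with
    | zero =>
      intro a ha
      rw [lengthPart, pow_zero, Submodule.one_eq_range] at ha
      obtain ⟨r, rfl⟩ := ha
      simp [Algebra.algebraMap_eq_smul_one, h1]
    | succ m ih =>
      intro a ha
      refine lengthPart_induction k (p := fun a => D x a ∈ lengthPart k (M := L) (m + 1))
        ?_ ?_ ha
      · intro a b ha hb
        rw [map_add]
        exact add_mem ha hb
      · intro b hb y
        rw [hmul, hι]
        exact add_mem (mul_ι_mem k (ih b hb) y) (mul_ι_mem k hb _)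
  have hvan : ∀ n m, n ≠ m → ∀ a ∈ lengthPart k (M := L) m, Φ n a = 0 := by
    intro n
    induction n with
    | zero =>
      intro m hm a ha
      obtain ⟨m, rfl⟩ := Nat.exists_eq_succ_of_ne_zero hm.symm
      refine lengthPart_induction k (p := fun a => Φ 0 a = 0) ?_ ?_ ha
      · intro a b ha hb
        rw [map_add, ha, hb, add_zero]
      · intro b _ x
        rw [hΦ0, hF₀]
    | succ n ih =>
      intro m hm a ha
      cases m with
      | zero =>
        rw [lengthPart, pow_zero, Submodule.one_eq_range] at ha
        obtain ⟨r, rfl⟩ := ha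
        simp [Algebra.algebraMap_eq_smul_one, hΦ1]
      | succ m =>
        refine lengthPart_induction k (p := fun a => Φ (n + 1) a = 0) ?_ ?_ ha
        · intro a b ha hb
          rw [map_add, ha, hb, add_zero]
        · intro b hb x
          have hnm : n ≠ m := fun h => hm (by rw [h])
          rw [hΦs, ih m hnm b hb, ih m hnm _ (hDmem m x b hb)]
          simp
  have hfin : ∀ a, ∃ N, ∀ n, N ≤ n → Φ n a = 0 := by
    intro a
    refine length_induction k (p := fun a => ∃ N, ∀ n, N ≤ n → Φ n a = 0) ?_ ?_ a
    · rintro a b ⟨N, hN⟩ ⟨N', hN'⟩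
      refine ⟨max N N', fun n hn => ?_⟩
      rw [map_add, hN n (le_trans (le_max_left _ _) hn), hN' n (le_trans (le_max_right _ _) hn),
        add_zero]
    · intro m a ha
      exact ⟨m + 1, fun n hn => hvan n m (by omega) a ha⟩
  have hsupp : ∀ a N, (∀ n, N ≤ n → Φ n a = 0) →
      ∑ᶠ n, Φ n a = ∑ n ∈ Finset.range N, Φ n a := by
    intro a N hN
    refine finsum_eq_sum_of_support_subset _ fun n hn => ?_
    by_contra h
    exact hn (hN n (by simpa using h))
  have hfs : ∀ a, (Function.support fun n => Φ n a).Finite := by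
    intro a
    obtain ⟨N, hN⟩ := hfin a
    refine (Finset.range N).finite_toSet.subset fun n hn => ?_
    by_contra h
    exact hn (hN n (by simpa using h))
  let F : SymmetricAlgebra k L →ₗ[k] (SymmetricAlgebra k L →ₗ[k] SymmetricAlgebra k L) :=
    { toFun := fun a => ∑ᶠ n, Φ n a
      map_add' := fun a b => by
        simp only [map_add]
        exact finsum_add_distrib (hfs a) (hfs b)
      map_smul' := fun r a => by
        simp only [map_smul, RingHom.id_apply]
        exact (smul_finsum' r (hfs a)).symm }
  refine ⟨F, ?_, fun B X => ?_⟩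
  · change ∑ᶠ n, Φ n 1 = _
    rw [hsupp 1 1 (fun n hn => by
      obtain ⟨n, rfl⟩ := Nat.exists_eq_succ_of_ne_zero (by omega : n ≠ 0)
      exact hΦ1 n)]
    simp [hΦ0, F₀]
  · obtain ⟨N, hN⟩ := hfin B
    obtain ⟨N', hN'⟩ := hfin (D X B)
    have hB := hsupp B (max N N') fun n hn => hN n (le_trans (le_max_left _ _) hn)
    have hDB := hsupp (D X B) (max N N') fun n hn => hN' n (le_trans (le_max_right _ _) hn)
    change ∑ᶠ n, Φ n (B * SymmetricAlgebra.ι k L X) =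
      D X ∘ₗ (∑ᶠ n, Φ n B) - ∑ᶠ n, Φ n (D X B)
    rw [hB, hDB, hsupp (B * SymmetricAlgebra.ι k L X) (max N N' + 1) ?_, Finset.sum_range_succ',
      hΦ0, hF₀, add_zero]
    · simp only [hΦs]
      rw [Finset.sum_sub_distrib]
      congr 1
      ext b
      simp
    · intro n hn
      obtain ⟨n, rfl⟩ := Nat.exists_eq_succ_of_ne_zero (by omega : n ≠ 0)
      rw [Nat.succ_eq_add_one, hΦs, hN n (by omega), hN' n (by omega)]
      simp

theorem exists_isExtension : ∃ c, IsExtension k L c := by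
  obtain ⟨D, h1, hι, hmul⟩ := exists_der k L
  obtain ⟨F, hF1, hF⟩ := exists_Φ k L D h1 hι hmul
  have hD : ∀ X A, F (SymmetricAlgebra.ι k L X) A = D X A := by
    intro X A
    have := hF 1 X
    rw [one_mul, h1, map_zero, sub_zero, hF1, LinearMap.comp_id] at this
    rw [this]
  have hDmem : ∀ m x, ∀ a ∈ lengthPart k (M := L) m, D x a ∈ lengthPart k (M := L) m := by
    intro m x
    induction m with
    | zero =>
      intro a ha
      rw [lengthPart, pow_zero, Submodule.one_eq_range] at ha
      obtain ⟨r, rfl⟩ := ha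
      simp [Algebra.algebraMap_eq_smul_one, h1]
    | succ m ih =>
      intro a ha
      refine lengthPart_induction k (p := fun a => D x a ∈ lengthPart k (M := L) (m + 1))
        ?_ ?_ ha
      · intro a b ha hb
        rw [map_add]
        exact add_mem ha hb
      · intro b hb y
        rw [hmul, hι]
        exact add_mem (mul_ι_mem k (ih b hb) y) (mul_ι_mem k hb _)
  refine ⟨F.flip, fun x y => ?_, fun A => ?_, fun T B X => ?_, fun A B C => ?_⟩
  · rw [LinearMap.flip_apply, hD, hι]
  · rw [LinearMap.flip_apply, hF1, LinearMap.id_apply]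
  · simp only [LinearMap.flip_apply]
    rw [hF, hD, hD, LinearMap.sub_apply, LinearMap.comp_apply]
  · refine length_induction k (p := fun C => F.flip (A * B) C =
      LinearMap.mul' k (SymmetricAlgebra k L)
        (TensorProduct.map (F.flip A) (F.flip B) (coproduct k L C))) ?_ ?_ C
    · intro a b ha hb
      simp only [map_add, ha, hb]
    · intro m
      induction m with
      | zero =>
        intro a ha
        rw [lengthPart, pow_zero, Submodule.one_eq_range] at ha
        obtain ⟨r, rfl⟩ := ha
        simp [Algebra.algebraMap_eq_smul_one, hF1, Algebra.TensorProduct.one_def]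
      | succ m ih =>
        intro a ha
        refine lengthPart_induction k (p := fun C => F.flip (A * B) C =
          LinearMap.mul' k (SymmetricAlgebra k L)
            (TensorProduct.map (F.flip A) (F.flip B) (coproduct k L C))) ?_ ?_ ha
        · intro a b ha hb
          simp only [map_add, ha, hb]
        · intro b hb x
          have e1 := ih b hb
          have e2 := ih (D x b) (hDmem m x b hb)
          rw [LinearMap.flip_apply] at e1 e2
          rw [LinearMap.flip_apply, hF, LinearMap.sub_apply, LinearMap.comp_apply, e1, e2,
            coproduct_der k L (D x) (fun y => y * x) (h1 x) (hι x) (hmul x), map_mul,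
            coproduct_ι]
          generalize coproduct k L b = t
          induction t using TensorProduct.induction_on with
          | zero => simp
          | add s t hs ht =>
            simp only [map_add, add_mul] at hs ht ⊢
            rw [← hs, ← ht]
            abel
          | tmul u v =>
            simp only [LinearMap.add_apply, LinearMap.rTensor_tmul, LinearMap.lTensor_tmul,
              mul_add, Algebra.TensorProduct.tmul_mul_tmul, mul_one, map_add, hmul,
              TensorProduct.map_tmul, LinearMap.mul'_apply, LinearMap.flip_apply, hF,
              LinearMap.sub_apply, LinearMap.comp_apply]
            ring

/-- Sums of tensors of elements of positive length, of total length `m`. -/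
theorem coproduct_mem {m : ℕ} {a : SymmetricAlgebra k L}
    (ha : a ∈ lengthPart k (M := L) (m + 1)) :
    coproduct k L a - (a ⊗ₜ[k] 1 + 1 ⊗ₜ[k] a) ∈ Submodule.span k
      {t | ∃ u v : SymmetricAlgebra k L, ∃ i j : ℕ, u ∈ lengthPart k (M := L) (i + 1) ∧
        v ∈ lengthPart k (M := L) (j + 1) ∧ i + j + 2 = m + 1 ∧ t = u ⊗ₜ[k] v} := by
  induction m generalizing a with
  | zero =>
    refine lengthPart_induction k (p := fun a => coproduct k L a - (a ⊗ₜ[k] 1 + 1 ⊗ₜ[k] a) ∈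
      Submodule.span k _) ?_ ?_ ha
    · intro a b ha hb
      convert add_mem ha hb using 1
      simp only [map_add, TensorProduct.add_tmul, TensorProduct.tmul_add]
      abel
    · intro b hb x
      rw [lengthPart, pow_zero, Submodule.one_eq_range] at hb
      obtain ⟨r, rfl⟩ := hb
      convert Submodule.zero_mem (Submodule.span k _) using 1
      simp [Algebra.algebraMap_eq_smul_one, coproduct_ι, TensorProduct.smul_tmul',
        TensorProduct.tmul_smul]
  | succ m ih =>
    refine lengthPart_induction k (p := fun a => coproduct k L a - (a ⊗ₜ[k] 1 + 1 ⊗ₜ[k] a) ∈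
      Submodule.span k _) ?_ ?_ ha
    · intro a b ha hb
      convert add_mem ha hb using 1
      simp only [map_add, TensorProduct.add_tmul, TensorProduct.tmul_add]
      abel
    · intro b hb x
      have hx : SymmetricAlgebra.ι k L x ∈ lengthPart k (M := L) (0 + 1) := by
        rw [lengthPart, zero_add, pow_one]
        exact ⟨x, rfl⟩
      have key : ∀ t ∈ Submodule.span k
          {t | ∃ u v : SymmetricAlgebra k L, ∃ i j : ℕ, u ∈ lengthPart k (M := L) (i + 1) ∧
            v ∈ lengthPart k (M := L) (j + 1) ∧ i + j + 2 = m + 1 ∧ t = u ⊗ₜ[k] v},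
          t * (SymmetricAlgebra.ι k L x ⊗ₜ[k] 1 + 1 ⊗ₜ[k] SymmetricAlgebra.ι k L x) ∈
          Submodule.span k
          {t | ∃ u v : SymmetricAlgebra k L, ∃ i j : ℕ, u ∈ lengthPart k (M := L) (i + 1) ∧
            v ∈ lengthPart k (M := L) (j + 1) ∧ i + j + 2 = m + 1 + 1 ∧ t = u ⊗ₜ[k] v} := by
        intro t ht
        induction ht using Submodule.span_induction with
        | mem t ht =>
          obtain ⟨u, v, i, j, hu, hv, hij, rfl⟩ := ht
          rw [mul_add, Algebra.TensorProduct.tmul_mul_tmul, Algebra.TensorProduct.tmul_mul_tmul,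
            mul_one, mul_one]
          exact add_mem
            (Submodule.subset_span ⟨_, _, i + 1, j, mul_ι_mem k hu x, hv, by omega, rfl⟩)
            (Submodule.subset_span ⟨_, _, i, j + 1, hu, mul_ι_mem k hv x, by omega, rfl⟩)
        | zero => rw [zero_mul]; exact zero_mem _
        | add s t _ _ hs ht => rw [add_mul]; exact add_mem hs ht
        | smul r t _ ht => rw [smul_mul_assoc]; exact Submodule.smul_mem _ _ ht
      have h1 := key _ (ih hb)
      have h2 : b ⊗ₜ[k] SymmetricAlgebra.ι k L x ∈ Submodule.span k
          {t | ∃ u v : SymmetricAlgebra k L, ∃ i j : ℕ, u ∈ lengthPart k (M := L) (i + 1) ∧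
            v ∈ lengthPart k (M := L) (j + 1) ∧ i + j + 2 = m + 1 + 1 ∧ t = u ⊗ₜ[k] v} :=
        Submodule.subset_span ⟨_, _, m, 0, hb, hx, by omega, rfl⟩
      have h3 : SymmetricAlgebra.ι k L x ⊗ₜ[k] b ∈ Submodule.span k
          {t | ∃ u v : SymmetricAlgebra k L, ∃ i j : ℕ, u ∈ lengthPart k (M := L) (i + 1) ∧
            v ∈ lengthPart k (M := L) (j + 1) ∧ i + j + 2 = m + 1 + 1 ∧ t = u ⊗ₜ[k] v} :=
        Submodule.subset_span ⟨_, _, 0, m, hx, hb, by omega, rfl⟩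
      convert add_mem (add_mem h1 h2) h3 using 1
      rw [map_mul, coproduct_ι, sub_mul, add_mul (b ⊗ₜ[k] 1)]
      simp only [mul_add, Algebra.TensorProduct.tmul_mul_tmul, mul_one, one_mul]
      abel

variable {k L} in
theorem IsExtension.one_left {c : SymmetricAlgebra k L →ₗ[k] SymmetricAlgebra k L →ₗ[k]
    SymmetricAlgebra k L} (hc : IsExtension k L c) (m : ℕ) {a : SymmetricAlgebra k L}
    (ha : a ∈ lengthPart k (M := L) (m + 1)) : c 1 a = 0 := by
  induction m using Nat.strong_induction_on generalizing a with
  | _ m ih =>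
    have h := hc.mul_left 1 1 a
    have h0 : ∀ t ∈ Submodule.span k
        {t | ∃ u v : SymmetricAlgebra k L, ∃ i j : ℕ, u ∈ lengthPart k (M := L) (i + 1) ∧
          v ∈ lengthPart k (M := L) (j + 1) ∧ i + j + 2 = m + 1 ∧ t = u ⊗ₜ[k] v},
        LinearMap.mul' k (SymmetricAlgebra k L) (TensorProduct.map (c 1) (c 1) t) = 0 := by
      intro t ht
      induction ht using Submodule.span_induction with
      | mem t ht =>
        obtain ⟨u, v, i, j, hu, hv, hij, rfl⟩ := ht
        simp [ih i (by omega) hu]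
      | zero => simp
      | add s t _ _ hs ht => rw [map_add, map_add, hs, ht, add_zero]
      | smul r t _ ht => rw [map_smul, map_smul, ht, smul_zero]
    have h1 := h0 _ (coproduct_mem k L ha)
    rw [map_sub, map_sub, ← h] at h1
    simp only [mul_one, map_add, TensorProduct.map_tmul, LinearMap.mul'_apply, hc.one_right,
      one_mul] at h1
    rw [sub_add_cancel_left, neg_eq_zero] at h1
    exact h1

theorem existsUnique_isExtension : ∃! c, IsExtension k L c := by
  obtain ⟨c, hc⟩ := exists_isExtension k L
  refine ⟨c, hc, fun c' hc' => ?_⟩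
  have hx : ∀ x : L, SymmetricAlgebra.ι k L x ∈ lengthPart k (M := L) (0 + 1) := by
    intro x
    rw [lengthPart, zero_add, pow_one]
    exact ⟨x, rfl⟩
  have hone : ∀ a, c' 1 a = c 1 a := by
    intro a
    refine length_induction k (p := fun a => c' 1 a = c 1 a) ?_ ?_ a
    · intro a b ha hb
      rw [map_add, map_add, ha, hb]
    · intro m a ha
      cases m with
      | zero =>
        rw [lengthPart, pow_zero, Submodule.one_eq_range] at ha
        obtain ⟨r, rfl⟩ := ha
        simp [Algebra.algebraMap_eq_smul_one, hc.one_right, hc'.one_right]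
      | succ m => rw [hc.one_left m ha, hc'.one_left m ha]
  have hι : ∀ x A, c' A (SymmetricAlgebra.ι k L x) = c A (SymmetricAlgebra.ι k L x) := by
    intro x A
    induction A using SymmetricAlgebra.induction with
    | algebraMap r =>
      rw [Algebra.algebraMap_eq_smul_one, map_smul, map_smul, LinearMap.smul_apply,
        LinearMap.smul_apply, hone]
    | ι y => rw [hc.extends_mul, hc'.extends_mul]
    | mul a b ha hb =>
      rw [hc.mul_left, hc'.mul_left, coproduct_ι]
      simp [ha, hb, hc.one_right, hc'.one_right]
    | add a b ha hb => rw [map_add, map_add, LinearMap.add_apply, LinearMap.add_apply, ha, hb]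
  have hmem : ∀ m x, ∀ a ∈ lengthPart k (M := L) m,
      c a (SymmetricAlgebra.ι k L x) ∈ lengthPart k (M := L) m := by
    intro m x
    induction m with
    | zero =>
      intro a ha
      rw [lengthPart, pow_zero, Submodule.one_eq_range] at ha
      obtain ⟨r, rfl⟩ := ha
      simp [Algebra.algebraMap_eq_smul_one, hc.one_left 0 (hx x)]
    | succ m ih =>
      intro a ha
      refine lengthPart_induction k
        (p := fun a => c a (SymmetricAlgebra.ι k L x) ∈ lengthPart k (M := L) (m + 1)) ?_ ?_ ha
      · intro a b ha hb
        rw [map_add, LinearMap.add_apply]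
        exact add_mem ha hb
      · intro b hb y
        rw [hc.mul_left, coproduct_ι]
        simp only [map_add, TensorProduct.map_tmul, LinearMap.mul'_apply, hc.one_right,
          hc.extends_mul]
        exact add_mem (mul_ι_mem k (ih b hb) y) (mul_ι_mem k hb _)
  have hgen : ∀ T m, ∀ C ∈ lengthPart k (M := L) m,
      c' (SymmetricAlgebra.ι k L T) C = c (SymmetricAlgebra.ι k L T) C := by
    intro T m
    induction m with
    | zero =>
      intro a ha
      rw [lengthPart, pow_zero, Submodule.one_eq_range] at ha
      obtain ⟨r, rfl⟩ := ha
      simp [Algebra.algebraMap_eq_smul_one, hc.one_right, hc'.one_right]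
    | succ m ih =>
      intro a ha
      refine lengthPart_induction k
        (p := fun C => c' (SymmetricAlgebra.ι k L T) C = c (SymmetricAlgebra.ι k L T) C) ?_ ?_ ha
      · intro a b ha hb
        rw [map_add, map_add, ha, hb]
      · intro b hb y
        rw [hc.ι_mul, hc'.ι_mul, hι, hι, ih b hb, ih _ (hmem m y b hb)]
  refine LinearMap.ext fun A => ?_
  induction A using SymmetricAlgebra.induction with
  | algebraMap r =>
    rw [Algebra.algebraMap_eq_smul_one, map_smul, map_smul]
    exact congrArg _ (LinearMap.ext hone)
  | ι x =>
    refine LinearMap.ext fun C => ?_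
    exact length_induction k
      (p := fun C => c' (SymmetricAlgebra.ι k L x) C = c (SymmetricAlgebra.ι k L x) C)
      (fun a b ha hb => by rw [map_add, map_add, ha, hb]) (hgen x) C
  | mul a b ha hb =>
    refine LinearMap.ext fun C => ?_
    rw [hc.mul_left, hc'.mul_left, ha, hb]
  | add a b ha hb => rw [map_add, map_add, ha, hb]

/-- The product `∘` on the symmetric algebra of a right pre-Lie algebra: the unique extension of
the pre-Lie product in the sense of `IsExtension`. -/
def circ : SymmetricAlgebra k L →ₗ[k] SymmetricAlgebra k L →ₗ[k] SymmetricAlgebra k L :=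
  (existsUnique_isExtension k L).choose

theorem circ_isExtension : IsExtension k L (circ k L) :=
  (existsUnique_isExtension k L).choose_spec.1

/-- The product `A ⋆ B = (A ∘ B₍₁₎) B₍₂₎` on the symmetric algebra of a right pre-Lie algebra. -/
def starProduct (A B : SymmetricAlgebra k L) : SymmetricAlgebra k L :=
  LinearMap.mul' k (SymmetricAlgebra k L)
    ((circ k L A).rTensor (SymmetricAlgebra k L) (coproduct k L B))

end General

section Trees

/-- Planar rooted trees: a planar rooted tree is either a single vertex, or is obtained in exactly
one way from a planar rooted tree `t` by adding a last branch `s`, i.e. by joining the root of `s`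
by a new edge to the root of `t`, as the last child of that root. -/
inductive PlanarTree : Type
  | vertex : PlanarTree
  | addBranch (t s : PlanarTree) : PlanarTree

namespace PlanarTree

/-- The vertices of a planar rooted tree: those of `t` and those of `s` for `addBranch t s`. -/
def Vert : PlanarTree → Type
  | vertex => Unit
  | addBranch t s => Vert t ⊕ Vert s

/-- The vertices form a finite type. -/
instance instFintypeVert : (t : PlanarTree) → Fintype (Vert t)
  | vertex => inferInstanceAs (Fintype Unit)
  | addBranch t s =>
    let _ := instFintypeVert t
    let _ := instFintypeVert s
    inferInstanceAs (Fintype (Vert t ⊕ Vert s))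

/-- `graftAt t v s` is the tree `t ∘_v s` obtained by joining the root of `s` by a new edge to the
vertex `v` of `t`. -/
def graftAt : (t : PlanarTree) → Vert t → PlanarTree → PlanarTree
  | vertex, _, s => addBranch vertex s
  | addBranch t a, Sum.inl v, s => addBranch (graftAt t v s) a
  | addBranch t a, Sum.inr v, s => addBranch t (graftAt a v s)

/-- Isomorphism of the underlying (non planar) rooted trees: the smallest congruence that allows to
exchange two consecutive branches at a vertex. -/
inductive Iso : PlanarTree → PlanarTree → Prop
  | refl (t : PlanarTree) : Iso t t
  | symm {t t' : PlanarTree} : Iso t t' → Iso t' t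
  | trans {t t' t'' : PlanarTree} : Iso t t' → Iso t' t'' → Iso t t''
  | congr {t t' s s' : PlanarTree} : Iso t t' → Iso s s' → Iso (addBranch t s) (addBranch t' s')
  | swap (t a b : PlanarTree) : Iso (addBranch (addBranch t a) b) (addBranch (addBranch t b) a)

/-- Isomorphism is an equivalence relation. -/
instance instSetoid : Setoid PlanarTree := ⟨Iso, Iso.refl, Iso.symm, Iso.trans⟩

end PlanarTree

/-- (Isomorphism classes of finite) rooted trees: planar rooted trees, up to the order of the
branches at each vertex. -/
def Tree : Type := Quotient PlanarTree.instSetoid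

namespace Tree

open PlanarTree

/-- The rooted tree underlying a planar rooted tree. -/
def mk (t : PlanarTree) : Tree := Quotient.mk _ t

instance : DecidableEq Tree := Classical.decEq Tree

theorem mk_eq {t t' : PlanarTree} (h : Iso t t') : mk t = mk t' := Quotient.sound h

theorem exists_mk (T : Tree) : ∃ t, mk t = T := Quotient.exists_rep T

/-- The tree with a single vertex. -/
def vertex : Tree := mk PlanarTree.vertex

/-- `addBranch T S` is obtained by joining the root of `S` to the root of `T`. -/
def addBranch : Tree → Tree → Tree :=
  Quotient.map₂ PlanarTree.addBranch fun _ _ h _ _ h' => Iso.congr h h'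

theorem addBranch_right_comm (T A B : Tree) :
    addBranch (addBranch T A) B = addBranch (addBranch T B) A := by
  obtain ⟨t, rfl⟩ := exists_mk T
  obtain ⟨a, rfl⟩ := exists_mk A
  obtain ⟨b, rfl⟩ := exists_mk B
  exact mk_eq (Iso.swap t a b)

instance : RightCommutative addBranch := ⟨addBranch_right_comm⟩

theorem tree_induction {p : Tree → Prop} (h0 : p vertex)
    (h : ∀ T S, p T → p S → p (addBranch T S)) (T : Tree) : p T := by
  induction T using Quotient.inductionOn with
  | _ t =>
    induction t with
    | vertex => exact h0
    | addBranch t s ht hs => exact h _ _ ht hs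

/-- `node F` is the tree whose root has the trees of the forest `F` (a multiset of trees) as its
branches. -/
def node (F : Multiset Tree) : Tree := F.foldl addBranch vertex

theorem node_cons (T : Tree) (F : Multiset Tree) : node (T ::ₘ F) = addBranch (node F) T := by
  have h : ∀ R, (T ::ₘ F).foldl addBranch R = addBranch (F.foldl addBranch R) T := by
    induction F using Multiset.induction_on with
    | empty => exact fun R => rfl
    | cons S F ih =>
      intro R
      rw [Multiset.cons_swap, Multiset.foldl_cons, ih, Multiset.foldl_cons]
  exact h vertex

/-- The planar version of `children`. -/
def childrenAux : PlanarTree → Multiset Tree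
  | .vertex => 0
  | .addBranch t s => mk s ::ₘ childrenAux t

theorem childrenAux_iso {t t' : PlanarTree} (h : Iso t t') : childrenAux t = childrenAux t' := by
  induction h with
  | refl => rfl
  | symm _ ih => exact ih.symm
  | trans _ _ ih ih' => exact ih.trans ih'
  | congr h h' ih ih' =>
    rw [childrenAux, childrenAux, ih]
    congr 1
    exact mk_eq h'
  | swap t a b =>
    simp only [childrenAux]
    exact Multiset.cons_swap _ _ _

/-- The forest of the branches of a tree at its root. -/
def children : Tree → Multiset Tree := Quotient.lift childrenAux fun _ _ h => childrenAux_iso h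

theorem children_addBranch (T S : Tree) : (addBranch T S).children = S ::ₘ T.children := by
  obtain ⟨t, rfl⟩ := exists_mk T
  obtain ⟨s, rfl⟩ := exists_mk S
  rfl

/-- A rooted tree is the same as the multiset of its branches. -/
def equivForest : Tree ≃ Multiset Tree where
  toFun := children
  invFun := node
  left_inv T := by
    induction T using tree_induction with
    | h0 => rfl
    | h T S hT hS =>
      rw [children_addBranch, node_cons, hT]
  right_inv F := by
    induction F using Multiset.induction_on with
    | empty => rfl
    | cons S F ih =>
      rw [node_cons]
      rw [children_addBranch, ih]

/-- The planar version of `grafts`. -/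
def graftsAux (t s : PlanarTree) : Multiset Tree :=
  (Finset.univ : Finset (Vert t)).val.map fun v => mk (graftAt t v s)

theorem graftsAux_vertex (s : PlanarTree) :
    graftsAux .vertex s = {addBranch vertex (mk s)} := rfl

theorem graftsAux_addBranch (t a s : PlanarTree) : graftsAux (.addBranch t a) s =
    (graftsAux t s).map (fun T => addBranch T (mk a)) +
      (graftsAux a s).map (fun A => addBranch (mk t) A) := by
  change Multiset.map _ (Multiset.map Sum.inl Finset.univ.val +
    Multiset.map Sum.inr Finset.univ.val) = _
  refine (Multiset.map_add _ _ _).trans ?_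
  rw [graftsAux, graftsAux, Multiset.map_map, Multiset.map_map]
  congr 1
  · exact Multiset.map_map _ _ _
  · exact Multiset.map_map _ _ _

theorem graftAt_iso (t : PlanarTree) (v : Vert t) {s s' : PlanarTree} (h : Iso s s') :
    Iso (graftAt t v s) (graftAt t v s') := by
  induction t with
  | vertex => exact Iso.congr (Iso.refl _) h
  | addBranch t a iht iha =>
    rcases v with v | v
    · exact Iso.congr (iht v) (Iso.refl _)
    · exact Iso.congr (Iso.refl _) (iha v)

theorem graftsAux_iso {t t' s s' : PlanarTree} (ht : Iso t t') (hs : Iso s s') :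
    graftsAux t s = graftsAux t' s' := by
  have h1 : graftsAux t s = graftsAux t s' := by
    rw [graftsAux, graftsAux]
    refine Multiset.map_congr rfl fun v _ => mk_eq (graftAt_iso t v hs)
  rw [h1]
  clear h1 hs
  induction ht with
  | refl => rfl
  | symm _ ih => exact ih.symm
  | trans _ _ ih ih' => exact ih.trans ih'
  | congr h h' ih ih' =>
    rw [graftsAux_addBranch, graftsAux_addBranch, ih, ih']
    congr 1
    · rw [show mk _ = mk _ from mk_eq h']
    · rw [show mk _ = mk _ from mk_eq h]
  | swap t a b =>
    simp only [graftsAux_addBranch, Multiset.map_add, Multiset.map_map, Function.comp_def]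
    simp only [addBranch_right_comm _ _ (mk b)]
    rw [add_right_comm]
    congr 1
    congr 1
    · refine Multiset.map_congr rfl fun A _ => ?_
      exact addBranch_right_comm (mk t) (mk a) A

/-- The multiset of the trees `T ∘_v S`, where `v` runs through the vertices of `T`. -/
def grafts : Tree → Tree → Multiset Tree :=
  Quotient.lift₂ graftsAux fun _ _ _ _ h h' => graftsAux_iso h h'

theorem grafts_vertex (S : Tree) : grafts vertex S = {addBranch vertex S} := by
  obtain ⟨s, rfl⟩ := exists_mk S
  rfl

theorem grafts_addBranch (T A S : Tree) : grafts (addBranch T A) S =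
    (grafts T S).map (fun T' => addBranch T' A) + (grafts A S).map (fun A' => addBranch T A') := by
  obtain ⟨t, rfl⟩ := exists_mk T
  obtain ⟨a, rfl⟩ := exists_mk A
  obtain ⟨s, rfl⟩ := exists_mk S
  exact graftsAux_addBranch t a s

/-- The planar version of `aut`. -/
def autAux : PlanarTree → ℕ
  | .vertex => 1
  | .addBranch t s => autAux t * autAux s * ((childrenAux t).count (mk s) + 1)

theorem autAux_iso {t t' : PlanarTree} (h : Iso t t') : autAux t = autAux t' := by
  induction h with
  | refl => rfl
  | symm _ ih => exact ih.symm
  | trans _ _ ih ih' => exact ih.trans ih'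
  | congr h h' ih ih' => rw [autAux, autAux, ih, ih', mk_eq h', childrenAux_iso h]
  | swap t a b =>
    simp only [autAux, childrenAux, Multiset.count_cons]
    by_cases hab : mk a = mk b
    · simp only [hab, if_true]
      ring
    · simp only [hab, Ne.symm hab, if_false]
      ring

/-- The order of the automorphism group of a rooted tree. When a branch `S` is added to a tree `T`
that has `m` branches isomorphic to `S`, it is multiplied by `(m + 1) |Aut S|`. -/
def aut : Tree → ℕ := Quotient.lift autAux fun _ _ h => autAux_iso h

theorem aut_addBranch (T S : Tree) :
    (addBranch T S).aut = T.aut * S.aut * (T.children.count S + 1) := by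
  obtain ⟨t, rfl⟩ := exists_mk T
  obtain ⟨s, rfl⟩ := exists_mk S
  rfl

theorem card_vert_iso {t t' : PlanarTree} (h : Iso t t') :
    Fintype.card (Vert t) = Fintype.card (Vert t') := by
  have := congrArg Multiset.card (graftsAux_iso h (Iso.refl .vertex))
  rw [graftsAux, graftsAux, Multiset.card_map, Multiset.card_map] at this
  exact this

/-- The number of vertices of a rooted tree. -/
def numVertices : Tree → ℕ :=
  Quotient.lift (fun t => Fintype.card (Vert t)) fun _ _ h => card_vert_iso h

end Tree

variable (k : Type*) [CommRing k]

/-- The free `k`-module on the set of rooted trees. -/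
def PL : Type _ := Tree →₀ k

namespace PL

instance : AddCommGroup (PL k) := inferInstanceAs (AddCommGroup (Tree →₀ k))

instance : Module k (PL k) := inferInstanceAs (Module k (Tree →₀ k))

/-- The basis of `PL k` formed by the rooted trees. -/
def basis : Module.Basis Tree k (PL k) := ⟨LinearEquiv.refl k (Tree →₀ k)⟩

/-- The pre-Lie product: on trees, `T ∘ S` is the sum of the trees `T ∘_v S`, where `v` runs through
the vertices of `T`. -/
def preLie : PL k →ₗ[k] PL k →ₗ[k] PL k :=
  (basis k).constr k fun T => (basis k).constr k fun S => ((T.grafts S).map (basis k)).sum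

/-- The bilinear extension of `Tree.addBranch`. -/
def addBranch : PL k →ₗ[k] PL k →ₗ[k] PL k :=
  (basis k).constr k fun T => (basis k).constr k fun S => basis k (T.addBranch S)

theorem preLie_basis (T S : Tree) :
    preLie k (basis k T) (basis k S) = ((T.grafts S).map (basis k)).sum := by
  rw [preLie, Module.Basis.constr_basis, Module.Basis.constr_basis]

theorem addBranch_basis (T S : Tree) :
    addBranch k (basis k T) (basis k S) = basis k (T.addBranch S) := by
  rw [addBranch, Module.Basis.constr_basis, Module.Basis.constr_basis]

theorem induction_basis {p : PL k → Prop} (add : ∀ x y, p x → p y → p (x + y))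
    (smul : ∀ (r : k) x, p x → p (r • x)) (h : ∀ T, p (basis k T)) (x : PL k) : p x := by
  have hx : x ∈ Submodule.span k (Set.range (basis k)) := by
    rw [(basis k).span_eq]
    exact Submodule.mem_top
  induction hx using Submodule.span_induction with
  | mem x hx => obtain ⟨T, rfl⟩ := hx; exact h T
  | zero => simpa using smul 0 _ (h Tree.vertex)
  | add x y _ _ hx hy => exact add x y hx hy
  | smul r x _ hx => exact smul r x hx

theorem addBranch_right_comm (x y z : PL k) :
    addBranch k (addBranch k x y) z = addBranch k (addBranch k x z) y := by
  induction x using induction_basis k with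
  | add a b ha hb => simp only [map_add, LinearMap.add_apply, ha, hb]
  | smul r a ha => simp only [map_smul, LinearMap.smul_apply, ha]
  | h T =>
    induction y using induction_basis k with
    | add a b ha hb => simp only [map_add, LinearMap.add_apply, ha, hb]
    | smul r a ha => simp only [map_smul, LinearMap.smul_apply, ha]
    | h A =>
      induction z using induction_basis k with
      | add a b ha hb => simp only [map_add, LinearMap.add_apply, ha, hb]
      | smul r a ha => simp only [map_smul, LinearMap.smul_apply, ha]
      | h B => simp only [addBranch_basis, Tree.addBranch_right_comm T A B]

theorem preLie_vertex (y : PL k) :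
    preLie k (basis k Tree.vertex) y = addBranch k (basis k Tree.vertex) y := by
  refine LinearMap.congr_fun (?_ : preLie k (basis k Tree.vertex) = _) y
  refine (basis k).ext fun S => ?_
  rw [preLie_basis, addBranch_basis, Tree.grafts_vertex]
  simp

theorem preLie_addBranch (x y z : PL k) : preLie k (addBranch k x y) z =
    addBranch k (preLie k x z) y + addBranch k x (preLie k y z) := by
  induction x using induction_basis k with
  | add a b ha hb =>
    simp only [map_add, LinearMap.add_apply, ha, hb]
    exact add_add_add_comm _ _ _ _
  | smul r a ha => simp only [map_smul, LinearMap.smul_apply, ha, smul_add]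
  | h T =>
    induction y using induction_basis k with
    | add a b ha hb =>
      simp only [map_add, LinearMap.add_apply, ha, hb]
      exact add_add_add_comm _ _ _ _
    | smul r a ha => simp only [map_smul, LinearMap.smul_apply, ha, smul_add]
    | h A =>
      induction z using induction_basis k with
      | add a b ha hb =>
        simp only [map_add, LinearMap.add_apply, ha, hb]
        exact add_add_add_comm _ _ _ _
      | smul r a ha => simp only [map_smul, LinearMap.smul_apply, ha, smul_add]
      | h S =>
        rw [addBranch_basis, preLie_basis, preLie_basis, preLie_basis, Tree.grafts_addBranch,
          Multiset.map_add, Multiset.sum_add, Multiset.map_map, Multiset.map_map]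
        congr 1
        · rw [← LinearMap.flip_apply, map_multiset_sum, Multiset.map_map]
          simp only [Function.comp_def, LinearMap.flip_apply, addBranch_basis]
        · rw [map_multiset_sum, Multiset.map_map]
          simp only [Function.comp_def, addBranch_basis]

theorem preLie_symm (x y z : PL k) :
    preLie k (preLie k x y) z - preLie k x (preLie k y z) =
      preLie k (preLie k x z) y - preLie k x (preLie k z y) := by
  induction x using induction_basis k with
  | add a b ha hb =>
    simp only [map_add, LinearMap.add_apply]
    rw [add_sub_add_comm, ha, hb, add_sub_add_comm]
  | smul r a ha =>
    simp only [map_smul, LinearMap.smul_apply]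
    rw [← smul_sub, ha, smul_sub]
  | h T =>
    induction T using Tree.tree_induction with
    | h0 =>
      simp only [preLie_vertex, preLie_addBranch]
      rw [add_sub_cancel_right, add_sub_cancel_right, addBranch_right_comm]
    | h T A hT hA =>
      rw [← addBranch_basis]
      simp only [preLie_addBranch, map_add, LinearMap.add_apply]
      have h1 := congrArg (fun w => addBranch k w (basis k A)) hT
      have h2 := congrArg (addBranch k (basis k T)) hA
      simp only [map_sub, LinearMap.sub_apply] at h1 h2
      have h3 := congrArg₂ (· + ·) h1 h2
      rw [← sub_eq_zero] at h3 ⊢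
      rw [← h3]
      abel

/-- The free module on rooted trees, with the product given by grafting, is a (right) pre-Lie
ring. -/
instance instRightPreLieRing : RightPreLieRing (PL k) where
  __ := (inferInstance : AddCommGroup (PL k))
  mul x y := preLie k x y
  left_distrib x y z := map_add (preLie k x) y z
  right_distrib x y z := by
    change preLie k (x + y) z = preLie k x z + preLie k y z
    rw [map_add, LinearMap.add_apply]
  zero_mul x := by
    change preLie k 0 x = 0
    rw [map_zero, LinearMap.zero_apply]
  mul_zero x := map_zero (preLie k x)
  assoc_symm' x y z := preLie_symm k x y z

instance instRightPreLieAlgebra : RightPreLieAlgebra k (PL k) where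
  smul_assoc r x y := by
    change preLie k (r • x) y = r • preLie k x y
    rw [map_smul, LinearMap.smul_apply]
  smul_comm r x y := by
    change r • preLie k x y = preLie k x (r • y)
    rw [map_smul]

end PL

/-- The symmetric algebra of the module of rooted trees, i.e. the polynomial algebra in the rooted
trees. -/
abbrev SPL : Type _ := SymmetricAlgebra k (PL k)

/-- The rooted tree `T`, as an element of `SPL k`. -/
def tree (T : Tree) : SPL k := SymmetricAlgebra.ι k (PL k) (PL.basis k T)

/-- The monomial in `SPL k` given by a forest (a multiset of trees). -/
def forest (F : Multiset Tree) : SPL k := (F.map (tree k)).prod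

/-- The basis of `SPL k` formed by the forests. -/
def forestBasis : Module.Basis (Multiset Tree) k (SPL k) :=
  (PL.basis k).symmetricAlgebra.reindex Finsupp.orderIsoMultiset.toEquiv

theorem forestBasis_apply (F : Multiset Tree) : forestBasis k F = forest k F := by
  have h : ∀ f : Tree →₀ ℕ,
      (MvPolynomial.aeval (tree k)) (MvPolynomial.monomial f (1 : k)) =
        forest k (Finsupp.toMultiset f) := by
    intro f
    rw [MvPolynomial.aeval_monomial, map_one, one_mul, forest, Finsupp.toMultiset_map,
      Finsupp.prod_toMultiset, Finsupp.prod_mapDomain_index (by simp) (by simp [pow_add])]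
  have h' := h (Multiset.toFinsupp F)
  rw [Multiset.toFinsupp_toMultiset] at h'
  rw [← h', forestBasis, Module.Basis.reindex_apply]
  rfl

/-- The linear operator `B₊`, which joins the trees of a forest to a new root. -/
def bPlus : SPL k →ₗ[k] SPL k := (forestBasis k).constr k fun F => tree k (Tree.node F)

theorem bPlus_forest (F : Multiset Tree) : bPlus k (forest k F) = tree k (Tree.node F) := by
  rw [← forestBasis_apply, bPlus, Module.Basis.constr_basis]


theorem forest_zero : forest k 0 = 1 := by simp [forest]

theorem forest_cons (T : Tree) (F : Multiset Tree) :
    forest k (T ::ₘ F) = tree k T * forest k F := by simp [forest]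

/-- The planar version of `cut`. -/
def cutAux : PlanarTree → SPL k ⊗[k] SPL k
  | .vertex => 1
  | .addBranch t s =>
    cutAux t * (tree k (Tree.mk s) ⊗ₜ[k] 1 + (bPlus k).lTensor (SPL k) (cutAux s))

theorem cutAux_iso {t t' : PlanarTree} (h : PlanarTree.Iso t t') : cutAux k t = cutAux k t' := by
  induction h with
  | refl => rfl
  | symm _ ih => exact ih.symm
  | trans _ _ ih ih' => exact ih.trans ih'
  | congr h h' ih ih' => rw [cutAux, cutAux, ih, ih', Tree.mk_eq h']
  | swap t a b => simp only [cutAux]; rw [mul_right_comm]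

/-- The Connes-Kreimer coproduct of the forest of the branches of a tree. -/
def cut : Tree → SPL k ⊗[k] SPL k := Quotient.lift (cutAux k) fun _ _ h => cutAux_iso k h

theorem cut_addBranch (T S : Tree) : cut k (T.addBranch S) =
    cut k T * (tree k S ⊗ₜ[k] 1 + (bPlus k).lTensor (SPL k) (cut k S)) := by
  obtain ⟨t, rfl⟩ := Tree.exists_mk T
  obtain ⟨s, rfl⟩ := Tree.exists_mk S
  rfl

theorem forest_ext {M : Type*} [AddCommGroup M] [Module k M] {f g : SPL k →ₗ[k] M}
    (h : ∀ F, f (forest k F) = g (forest k F)) : f = g :=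
  (forestBasis k).ext fun F => by rw [forestBasis_apply, h]

/-- There is exactly one algebra morphism `Δ` from the polynomial algebra in the rooted trees to
its tensor square such that `Δ ∘ B₊ = B₊ ⊗ 1 + (id ⊗ B₊) ∘ Δ`. -/
theorem existsUnique_connesKreimer : ∃! Δ : SPL k →ₐ[k] SPL k ⊗[k] SPL k,
    ∀ A, Δ (bPlus k A) = bPlus k A ⊗ₜ[k] 1 + (bPlus k).lTensor (SPL k) (Δ A) := by
  let f : PL k →ₗ[k] SPL k ⊗[k] SPL k := (PL.basis k).constr k fun T =>
    tree k T ⊗ₜ[k] 1 + (bPlus k).lTensor (SPL k) (cut k T)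
  have hf : ∀ T, SymmetricAlgebra.lift f (tree k T) =
      tree k T ⊗ₜ[k] 1 + (bPlus k).lTensor (SPL k) (cut k T) := by
    intro T
    rw [tree, SymmetricAlgebra.lift_ι_apply, Module.Basis.constr_basis]
    rfl
  have hF : ∀ F, SymmetricAlgebra.lift f (forest k F) = cut k (Tree.node F) := by
    intro F
    induction F using Multiset.induction_on with
    | empty => rw [forest_zero, map_one]; rfl
    | cons T F ih =>
      rw [forest_cons, map_mul, ih, hf, Tree.node_cons, cut_addBranch, mul_comm]
  refine ⟨SymmetricAlgebra.lift f, fun A => ?_, fun Δ hΔ => ?_⟩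
  · have h : (SymmetricAlgebra.lift f).toLinearMap ∘ₗ bPlus k =
        (TensorProduct.mk k (SPL k) (SPL k)).flip 1 ∘ₗ bPlus k +
          (bPlus k).lTensor (SPL k) ∘ₗ (SymmetricAlgebra.lift f).toLinearMap := by
      refine forest_ext k fun F => ?_
      simp only [LinearMap.comp_apply, LinearMap.add_apply, AlgHom.toLinearMap_apply, bPlus_forest,
        hf, hF, LinearMap.flip_apply, TensorProduct.mk_apply]
    exact LinearMap.congr_fun h A
  · have h : ∀ T : Tree, Δ (forest k T.children) = SymmetricAlgebra.lift f (forest k T.children) ∧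
        Δ (tree k T) = SymmetricAlgebra.lift f (tree k T) := by
      intro T
      have key : ∀ T : Tree, Δ (forest k T.children) =
          SymmetricAlgebra.lift f (forest k T.children) →
          Δ (tree k T) = SymmetricAlgebra.lift f (tree k T) := by
        intro T h
        have hT : Tree.node T.children = T := Tree.equivForest.symm_apply_apply T
        have h2 := hΔ (forest k T.children)
        rw [bPlus_forest, h, hT] at h2
        rw [h2, hf, hF, hT]
      induction T using Tree.tree_induction with
      | h0 =>
        have : Δ (forest k Tree.vertex.children) =
            SymmetricAlgebra.lift f (forest k Tree.vertex.children) := by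
          change Δ (forest k 0) = SymmetricAlgebra.lift f (forest k 0)
          rw [forest_zero, map_one, map_one]
        exact ⟨this, key _ this⟩
      | h T S hT hS =>
        have : Δ (forest k (T.addBranch S).children) =
            SymmetricAlgebra.lift f (forest k (T.addBranch S).children) := by
          rw [Tree.children_addBranch, forest_cons, map_mul, map_mul, hT.1, hS.2]
        exact ⟨this, key _ this⟩
    refine SymmetricAlgebra.algHom_ext ((PL.basis k).ext fun T => ?_)
    exact (h T).2

/-- The Connes-Kreimer coproduct: the unique algebra morphism `Δ` from the polynomial algebra in
the rooted trees to its tensor square such that `Δ ∘ B₊ = B₊ ⊗ 1 + (id ⊗ B₊) ∘ Δ`. -/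
def connesKreimer : SPL k →ₐ[k] SPL k ⊗[k] SPL k := (existsUnique_connesKreimer k).choose

theorem connesKreimer_bPlus (A : SPL k) : connesKreimer k (bPlus k A) =
    bPlus k A ⊗ₜ[k] 1 + (bPlus k).lTensor (SPL k) (connesKreimer k A) :=
  (existsUnique_connesKreimer k).choose_spec.1 A

open scoped Nat in
/-- The order of the automorphism group of a forest: automorphisms permute the isomorphic trees of
the forest and act on each tree, so the order is the product of the factorials of the multiplicities
of the trees and of the orders of the automorphism groups of the trees. -/
def forestAut (F : Multiset Tree) : ℕ :=
  (∏ T ∈ F.toFinset, (F.count T)!) * (F.map Tree.aut).prod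

theorem forestAut_cons (S : Tree) (F : Multiset Tree) :
    forestAut (S ::ₘ F) = forestAut F * S.aut * (F.count S + 1) := by
  have h : ∏ T ∈ (S ::ₘ F).toFinset, ((S ::ₘ F).count T).factorial =
      (∏ T ∈ F.toFinset, (F.count T).factorial) * (F.count S + 1) := by
    have e : ∀ (G : Multiset Tree) (s : Finset Tree), G.toFinset ⊆ s →
        ∏ T ∈ G.toFinset, (G.count T).factorial = ∏ T ∈ s, (G.count T).factorial := by
      intro G s hs
      refine Finset.prod_subset hs fun T _ hT => ?_
      rw [Multiset.count_eq_zero_of_notMem (by simpa using hT), Nat.factorial_zero]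
    have hmem : S ∈ (S ::ₘ F).toFinset := by simp
    rw [e F (S ::ₘ F).toFinset (by simp), ← Finset.mul_prod_erase _ _ hmem,
      ← Finset.mul_prod_erase _ (fun T => (F.count T).factorial) hmem, Multiset.count_cons_self,
      Nat.factorial_succ]
    rw [Finset.prod_congr rfl fun T hT => by
      rw [Multiset.count_cons_of_ne (Finset.ne_of_mem_erase hT)]]
    ring
  rw [forestAut, h, Multiset.map_cons, Multiset.prod_cons, forestAut]
  ring

/-- The automorphisms of a tree are those of the forest of its branches. -/
theorem aut_eq (T : Tree) : T.aut = forestAut T.children := by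
  induction T using Tree.tree_induction with
  | h0 => rfl
  | h T S hT _ =>
    rw [Tree.children_addBranch, forestAut_cons, ← hT, Tree.aut_addBranch]

/-- The pairing of the polynomial algebra in the rooted trees with itself, given on forests by
`⟨F, G⟩ = |Aut F|` if `F = G`, and `⟨F, G⟩ = 0` otherwise. -/
def pairing : SPL k →ₗ[k] SPL k →ₗ[k] k :=
  (forestBasis k).constr k fun F => (forestBasis k).constr k fun G =>
    if F = G then (forestAut F : k) else 0

theorem pairing_forest (F G : Multiset Tree) :
    pairing k (forest k F) (forest k G) = if F = G then (forestAut F : k) else 0 := by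
  rw [← forestBasis_apply, ← forestBasis_apply, pairing, Module.Basis.constr_basis,
    Module.Basis.constr_basis]

/-- The induced pairing of the tensor square with itself,
`⟨A ⊗ B, C ⊗ D⟩ = ⟨A, C⟩ ⟨B, D⟩`. -/
def pairingTensor : SPL k ⊗[k] SPL k →ₗ[k] SPL k ⊗[k] SPL k →ₗ[k] k :=
  LinearMap.BilinForm.tmul (pairing k) (pairing k)

theorem pairingTensor_tmul (A B C D : SPL k) :
    pairingTensor k (A ⊗ₜ[k] B) (C ⊗ₜ[k] D) = pairing k A C * pairing k B D := by
  rw [mul_comm]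
  exact LinearMap.BilinForm.tensorDistrib_tmul k k (pairing k) (pairing k) A B C D

/-- The opposite `τ ∘ Δ` of the Connes-Kreimer coproduct, `τ` being the flip of the two tensor
factors. -/
def connesKreimerOp : SPL k →ₗ[k] SPL k ⊗[k] SPL k :=
  (TensorProduct.comm k (SPL k) (SPL k)).toLinearMap ∘ₗ (connesKreimer k).toLinearMap

/-- The number of vertices of a forest. -/
def forestVertices (F : Multiset Tree) : ℕ := (F.map Tree.numVertices).sum

end Trees

end PreLieSym

end

noncomputable section

namespace PreLieSym

/-! ### The products `∘` and `⋆` on the symmetric algebra of a pre-Lie algebra. -/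

section General

variable (k : Type*) [CommRing k] (L : Type*) [RightPreLieRing L] [RightPreLieAlgebra k L]

/-! The identity `⟨A ⋆ B, C⟩ = ⟨A ⊗ B, Δ_CK^op(C)⟩` is proved by induction on `C`, for all `A` and
`B` at once. Every tree is `B₊` of the forest of its branches, so `S(PL)` is the smallest subspace
that contains `1` and is stable under products and `B₊` (`bPlus_induction`). Each of the three cases
is the adjoint of a property of `⋆`; write `ε` for the counit `algebraMapInv`.

For `C = 1`, the property is that `ε` is a character of `⋆` (`algebraMapInv_star`). For a product,
it is that `Δ` is a morphism for `⋆` (`coproduct_star`), combined with the duality of `Δ` and the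
polynomial product (`pairing_mul`). For `B₊`, let `R` be the adjoint of `B₊`, which maps a tree to
the forest of its branches and kills all other forests. The cocycle equation for `Δ_CK^op` becomes
`R(A ⋆ B) = ε(A) R(B) + R(A) ⋆ B` (`bPlusAdjoint_star`).

These properties are all checked on right multiplications by one element `x` of `L`, `A ⋆ x = A x +
A ∘ x`. This suffices because `A ⋆ (B ⋆ x) = (A ⋆ B) ⋆ x` (`star_starRight`) and because these
operators generate `S(L)` from `1` (`star_induction`). The only combinatorics of trees is in
`branches_mul`: grafting `y` on `B₊(F)` at the root gives the branches `F y`, and at the other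
vertices `F ∘ y`, so the total is `F ⋆ y`.

The duality of `Δ` and the product follows from the derivation `|Aut T| ∂/∂T`, adjoint to
multiplication by `T`. The last claims hold because the pairing is diagonal in the basis of forests,
with entries `|Aut F| ≠ 0`, and because there are finitely many forests with a bounded number of
vertices. -/

theorem ι_mem_lengthPart_one (x : L) :
    SymmetricAlgebra.ι k L x ∈ lengthPart k (M := L) (0 + 1) := by
  rw [lengthPart, zero_add, pow_one]
  exact ⟨x, rfl⟩

theorem circ_one_ι (x : L) : circ k L 1 (SymmetricAlgebra.ι k L x) = 0 :=
  (circ_isExtension k L).one_left 0 (ι_mem_lengthPart_one k L x)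

theorem circ_mul_ι (A B : SymmetricAlgebra k L) (x : L) :
    circ k L (A * B) (SymmetricAlgebra.ι k L x) =
      circ k L A (SymmetricAlgebra.ι k L x) * B + A * circ k L B (SymmetricAlgebra.ι k L x) := by
  rw [(circ_isExtension k L).mul_left, coproduct_ι]
  simp [(circ_isExtension k L).one_right]

theorem circ_ι_mem (m : ℕ) (x : L) {A : SymmetricAlgebra k L} (hA : A ∈ lengthPart k (M := L) m) :
    circ k L A (SymmetricAlgebra.ι k L x) ∈ lengthPart k (M := L) m := by
  induction m generalizing A with
  | zero =>
    rw [lengthPart, pow_zero, Submodule.one_eq_range] at hA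
    obtain ⟨r, rfl⟩ := hA
    simp [Algebra.algebraMap_eq_smul_one, circ_one_ι]
  | succ m ih =>
    refine lengthPart_induction k
      (p := fun A => circ k L A (SymmetricAlgebra.ι k L x) ∈ lengthPart k (M := L) (m + 1)) ?_ ?_ hA
    · intro a b ha hb
      rw [map_add, LinearMap.add_apply]
      exact add_mem ha hb
    · intro b hb y
      rw [circ_mul_ι, (circ_isExtension k L).extends_mul]
      exact add_mem (mul_ι_mem k (ih hb) y) (mul_ι_mem k hb _)

/-- The right action of `L` on its symmetric algebra by derivations, `A ↦ A ∘ x`. -/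
def circRight (x : L) : SymmetricAlgebra k L →ₗ[k] SymmetricAlgebra k L :=
  (circ k L).flip (SymmetricAlgebra.ι k L x)

theorem circRight_one (x : L) : circRight k L x 1 = 0 := circ_one_ι k L x

theorem circRight_ι (x y : L) :
    circRight k L x (SymmetricAlgebra.ι k L y) = SymmetricAlgebra.ι k L (y * x) :=
  (circ_isExtension k L).extends_mul y x

theorem circRight_mul (x : L) (A B : SymmetricAlgebra k L) :
    circRight k L x (A * B) = circRight k L x A * B + A * circRight k L x B :=
  circ_mul_ι k L A B x

theorem coproduct_circRight (x : L) (A : SymmetricAlgebra k L) :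
    coproduct k L (circRight k L x A) =
      ((circRight k L x).rTensor (SymmetricAlgebra k L) +
        (circRight k L x).lTensor (SymmetricAlgebra k L)) (coproduct k L A) :=
  coproduct_der k L (circRight k L x) (· * x) (circRight_one k L x) (circRight_ι k L x)
    (circRight_mul k L x) A

theorem circ_one_mul_ι (B : SymmetricAlgebra k L) (x : L) :
    circ k L 1 (B * SymmetricAlgebra.ι k L x) = 0 := by
  induction B using length_induction k with
  | add a b ha hb => rw [add_mul, map_add, ha, hb, add_zero]
  | h m a ha => exact (circ_isExtension k L).one_left m (mul_ι_mem k ha x)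

theorem circ_one_circRight (B : SymmetricAlgebra k L) (x : L) :
    circ k L 1 (circRight k L x B) = 0 := by
  induction B using sym_induction with
  | one => simp [circRight_one]
  | add a b ha hb => simp [ha, hb]
  | smul r a ha => simp [ha]
  | mul_ι a y ha =>
    rw [circRight_mul, map_add, circRight_ι, circ_one_mul_ι, circ_one_mul_ι, add_zero]

/-- The identity `A ∘ (B x) = (A ∘ B) ∘ x - A ∘ (B ∘ x)` for all `A` in the symmetric algebra. -/
theorem circ_mul_ι_right (A B : SymmetricAlgebra k L) (x : L) :
    circ k L A (B * SymmetricAlgebra.ι k L x) =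
      circRight k L x (circ k L A B) - circ k L A (circRight k L x B) := by
  induction A using SymmetricAlgebra.induction generalizing B with
  | algebraMap r =>
    -- For a constant `A` all three terms vanish: `1 ∘ B` is a scalar, and derivations kill scalars.
    have h : circRight k L x (circ k L 1 B) = 0 := by
      induction B using sym_induction with
      | one => rw [(circ_isExtension k L).one_right, circRight_one]
      | add a b ha hb => simp [ha, hb]
      | smul r a ha => simp [ha]
      | mul_ι a y ha => rw [circ_one_mul_ι, map_zero]
    simp [Algebra.algebraMap_eq_smul_one, circ_one_mul_ι, circ_one_circRight, h]
  | ι y => exact (circ_isExtension k L).ι_mul y B x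
  | add a b ha hb =>
    simp only [map_add, LinearMap.add_apply, ha, hb]
    abel
  -- Both sides are functions of `Δ(B)`, because `x` is primitive and `circRight` is a coderivation.
  -- On a pure tensor `u ⊗ v`, the two hypotheses and the Leibniz rule for `circRight` give the
  -- identity.
  | mul a b ha hb =>
    simp only [(circ_isExtension k L).mul_left, map_mul, coproduct_ι, coproduct_circRight]
    generalize coproduct k L B = t
    induction t using TensorProduct.induction_on with
    | zero => simp
    | add s t hs ht =>
      simp only [map_add, add_mul] at hs ht ⊢
      rw [hs, ht]
      abel
    | tmul u v =>
      simp only [LinearMap.add_apply, LinearMap.rTensor_tmul, LinearMap.lTensor_tmul,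
        mul_add, Algebra.TensorProduct.tmul_mul_tmul, mul_one, map_add, circRight_mul,
        TensorProduct.map_tmul, LinearMap.mul'_apply, ha, hb]
      ring

/-! ### Right multiplications for `⋆`, and the compatibility of `⋆` with the coproduct. -/

/-- The product `⋆` as a bilinear map. -/
def star : SymmetricAlgebra k L →ₗ[k] SymmetricAlgebra k L →ₗ[k] SymmetricAlgebra k L :=
  LinearMap.mk₂ k (starProduct k L)
    (by intros; simp [starProduct, LinearMap.rTensor_add])
    (by intros; simp [starProduct, LinearMap.rTensor_smul])
    (by intros; simp [starProduct])
    (by intros; simp [starProduct])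

theorem star_apply (A B : SymmetricAlgebra k L) : star k L A B = starProduct k L A B := rfl

theorem star_one (A : SymmetricAlgebra k L) : star k L A 1 = A := by
  simp [star_apply, starProduct, Algebra.TensorProduct.one_def, (circ_isExtension k L).one_right]

/-- The right multiplication `A ↦ A ⋆ x = A x + A ∘ x` by an element of `L`. -/
def starRight (x : L) : SymmetricAlgebra k L →ₗ[k] SymmetricAlgebra k L :=
  LinearMap.mulRight k (SymmetricAlgebra.ι k L x) + circRight k L x

theorem starRight_apply (x : L) (A : SymmetricAlgebra k L) :
    starRight k L x A = A * SymmetricAlgebra.ι k L x + circRight k L x A := rfl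

/-- This is the associativity of `⋆` when the last factor is in `L`. On a term `u ⊗ v` of `Δ(B)`,
the sum `A ∘ (u x) + A ∘ (u ∘ x)` collapses to `(A ∘ u) ∘ x` by `circ_mul_ι_right`, and the Leibniz
rule does the rest. -/
theorem star_starRight (A B : SymmetricAlgebra k L) (x : L) :
    star k L A (starRight k L x B) = starRight k L x (star k L A B) := by
  simp only [star_apply, starProduct, starRight_apply, map_add, map_mul, coproduct_circRight,
    coproduct_ι]
  generalize coproduct k L B = t
  induction t using TensorProduct.induction_on with
  | zero => simp
  | add s t hs ht =>
    simp only [map_add, add_mul] at hs ht ⊢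
    -- The goal is the sum of `hs` and `ht`. With all three in the form `_ = 0`, the right-hand side
    -- is split as `0 + 0` and each zero is replaced by one of the vanishing differences.
    rw [← sub_eq_zero] at hs ht ⊢
    rw [← add_zero (0 : SymmetricAlgebra k L)]
    nth_rw 2 [← hs]
    rw [← ht]
    abel
  | tmul u v =>
    simp only [LinearMap.add_apply, LinearMap.rTensor_tmul, LinearMap.lTensor_tmul,
      mul_add, Algebra.TensorProduct.tmul_mul_tmul, mul_one, map_add, circRight_mul,
      LinearMap.mul'_apply, circ_mul_ι_right]
    ring

variable {k L} in
/-- The symmetric algebra is generated from `1` by the operators `A ↦ A ⋆ x`. -/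
theorem star_induction {p : SymmetricAlgebra k L → Prop} (one : p 1)
    (add : ∀ a b, p a → p b → p (a + b)) (smul : ∀ (r : k) a, p a → p (r • a))
    (starRight : ∀ a x, p a → p (starRight k L x a)) (A : SymmetricAlgebra k L) : p A := by
  induction A using length_induction k with
  | add a b ha hb => exact add a b ha hb
  | h m a ha =>
    induction m generalizing a with
    | zero =>
      rw [lengthPart, pow_zero, Submodule.one_eq_range] at ha
      obtain ⟨r, rfl⟩ := ha
      simpa [Algebra.algebraMap_eq_smul_one] using smul r 1 one
    | succ m ih =>
      refine lengthPart_induction k (p := p) add (fun b hb x => ?_) ha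
      -- `b x = b ⋆ x - b ∘ x`, and `b ∘ x` has the same length as `b`, so the induction hypothesis
      -- covers it.
      have h := add _ _ (starRight b x (ih b hb))
        (smul (-1) _ (ih (circRight k L x b) (circ_ι_mem k L m x hb)))
      rwa [starRight_apply, neg_one_smul, add_neg_cancel_right] at h

theorem algebraMapInv_circRight (x : L) (A : SymmetricAlgebra k L) :
    SymmetricAlgebra.algebraMapInv (circRight k L x A) = 0 := by
  induction A using sym_induction with
  | one => simp [circRight_one]
  | add a b ha hb => simp [ha, hb]
  | smul r a ha => simp [ha]
  | mul_ι a y ha => simp [circRight_mul, circRight_ι, SymmetricAlgebra.algebraMapInv_ι]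

theorem algebraMapInv_star (A B : SymmetricAlgebra k L) :
    SymmetricAlgebra.algebraMapInv (star k L A B) =
      SymmetricAlgebra.algebraMapInv A * SymmetricAlgebra.algebraMapInv B := by
  induction B using star_induction with
  | one => simp [star_one]
  | add a b ha hb => simp [ha, hb, mul_add]
  | smul r a ha => simp [ha, mul_left_comm]
  | starRight B x hB =>
    rw [star_starRight]
    simp [starRight_apply, algebraMapInv_circRight, SymmetricAlgebra.algebraMapInv_ι]

/-- Multiplication by a primitive element and `circRight` are both coderivations, hence so is their
sum. -/
theorem coproduct_starRight (x : L) (A : SymmetricAlgebra k L) :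
    coproduct k L (starRight k L x A) =
      ((starRight k L x).rTensor (SymmetricAlgebra k L) +
        (starRight k L x).lTensor (SymmetricAlgebra k L)) (coproduct k L A) := by
  rw [starRight_apply, map_add, map_mul, coproduct_circRight, coproduct_ι]
  generalize coproduct k L A = t
  induction t using TensorProduct.induction_on with
  | zero => simp
  | add s t hs ht =>
    simp only [map_add, add_mul] at hs ht ⊢
    rw [← hs, ← ht]
    abel
  | tmul u v =>
    simp only [LinearMap.add_apply, LinearMap.rTensor_tmul, LinearMap.lTensor_tmul, mul_add,
      Algebra.TensorProduct.tmul_mul_tmul, mul_one, starRight_apply, TensorProduct.add_tmul,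
      TensorProduct.tmul_add]
    abel

/-- The coproduct is a morphism for the product `⋆`. -/
theorem coproduct_star (A B : SymmetricAlgebra k L) :
    coproduct k L (star k L A B) =
      TensorProduct.map₂ (star k L) (star k L) (coproduct k L A) (coproduct k L B) := by
  induction B using star_induction with
  | one =>
    rw [star_one, map_one]
    generalize coproduct k L A = t
    induction t using TensorProduct.induction_on with
    | zero => simp
    | add s t hs ht => rw [map_add, LinearMap.add_apply, ← hs, ← ht]
    | tmul u v => simp [Algebra.TensorProduct.one_def, star_one]
  | add a b ha hb => simp only [map_add, ha, hb]
  | smul r a ha => simp only [map_smul, ha]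
  | starRight B x hB =>
    -- `starRight` is a coderivation on both sides, and in each tensor factor it commutes with left
    -- multiplications for `⋆`.
    rw [star_starRight, coproduct_starRight, hB, coproduct_starRight]
    generalize coproduct k L A = s
    generalize coproduct k L B = t
    induction s using TensorProduct.induction_on with
    | zero => simp
    | add s s' hs hs' =>
      rw [map_add]
      exact (map_add _ _ _).trans (by rw [hs, hs']; rfl)
    | tmul u v =>
      induction t using TensorProduct.induction_on with
      | zero => simp
      | add t t' ht ht' => simp only [map_add, ht, ht']
      | tmul w z => simp [star_starRight]

theorem counit_coproduct (A : SymmetricAlgebra k L) :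
    TensorProduct.lid k _ ((SymmetricAlgebra.algebraMapInv (R := k)
      (M := L)).toLinearMap.rTensor (SymmetricAlgebra k L) (coproduct k L A)) = A := by
  have h : ((Algebra.TensorProduct.lid k (SymmetricAlgebra k L)).toAlgHom.comp
      (Algebra.TensorProduct.map SymmetricAlgebra.algebraMapInv
        (AlgHom.id k (SymmetricAlgebra k L)))).comp (coproduct k L) = AlgHom.id k _ := by
    refine SymmetricAlgebra.algHom_ext (LinearMap.ext fun x => ?_)
    simp [coproduct_ι, SymmetricAlgebra.algebraMapInv_ι]
  exact DFunLike.congr_fun h A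

end General

/-! ### The pairing on forests, and the duality of the coproduct and the polynomial product. -/

section Duality

variable (k : Type*) [CommRing k]

theorem forest_singleton (T : Tree) : forest k {T} = tree k T := by simp [forest]

theorem forest_induction {p : SPL k → Prop} (add : ∀ a b, p a → p b → p (a + b))
    (smul : ∀ (r : k) a, p a → p (r • a)) (h : ∀ F, p (forest k F)) (A : SPL k) : p A := by
  have hA : A ∈ Submodule.span k (Set.range (forestBasis k)) := by
    rw [(forestBasis k).span_eq]
    exact Submodule.mem_top
  induction hA using Submodule.span_induction with
  | mem x hx => obtain ⟨F, rfl⟩ := hx; rw [forestBasis_apply]; exact h F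
  | zero => simpa using smul 0 _ (h 0)
  | add x y _ _ hx hy => exact add x y hx hy
  | smul r x _ hx => exact smul r x hx

/-- The induction runs over trees `T`, for the forest of branches of `T`; this reaches every forest
`F`, since `F` is the forest of branches of `B₊(F)`. -/
theorem bPlus_induction {p : SPL k → Prop} (one : p 1) (add : ∀ a b, p a → p b → p (a + b))
    (smul : ∀ (r : k) a, p a → p (r • a)) (mul : ∀ a b, p a → p b → p (a * b))
    (bPlus : ∀ a, p a → p (bPlus k a)) (A : SPL k) : p A := by
  have hT : ∀ T : Tree, p (forest k T.children) := by
    intro T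
    induction T using Tree.tree_induction with
    | h0 =>
      change p (forest k 0)
      rwa [forest_zero]
    | h T S hT hS =>
      rw [Tree.children_addBranch, forest_cons]
      refine mul _ _ ?_ hT
      have h := bPlus _ hS
      rwa [bPlus_forest, show Tree.node S.children = S from
        Tree.equivForest.symm_apply_apply S] at h
  refine forest_induction k add smul (fun F => ?_) A
  have h := hT (Tree.node F)
  rwa [show (Tree.node F).children = F from Tree.equivForest.apply_symm_apply F] at h

theorem algebraMapInv_tree (T : Tree) : SymmetricAlgebra.algebraMapInv (tree k T) = 0 :=
  SymmetricAlgebra.algebraMapInv_ι _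

theorem pairing_one_left (A : SPL k) : pairing k 1 A = SymmetricAlgebra.algebraMapInv A := by
  suffices h : pairing k 1 = (SymmetricAlgebra.algebraMapInv (R := k) (M := PL k)).toLinearMap from
    LinearMap.congr_fun h A
  refine forest_ext k fun F => ?_
  rw [← forest_zero, pairing_forest]
  induction F using Multiset.induction_on with
  | empty => simp [forest_zero, forestAut]
  | cons T F _ => simp [forest_cons, algebraMapInv_tree]

theorem pairing_comm (A B : SPL k) : pairing k A B = pairing k B A := by
  suffices h : pairing k = (pairing k).flip from LinearMap.congr_fun₂ h A B
  refine forest_ext k fun F => forest_ext k fun G => ?_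
  rw [LinearMap.flip_apply, pairing_forest, pairing_forest]
  by_cases h : F = G
  · rw [h]
  · rw [if_neg h, if_neg (Ne.symm h)]

theorem pairing_one_right (A : SPL k) : pairing k A 1 = SymmetricAlgebra.algebraMapInv A := by
  rw [pairing_comm, pairing_one_left]

/-- The derivation adjoint to the multiplication by the tree `T`. -/
def treeDer (T : Tree) : SPL k →ₗ[k] SPL k :=
  (forestBasis k).constr k fun F => ((T.aut * F.count T : ℕ) : k) • forest k (F.erase T)

theorem treeDer_forest (T : Tree) (F : Multiset Tree) :
    treeDer k T (forest k F) = ((T.aut * F.count T : ℕ) : k) • forest k (F.erase T) := by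
  rw [← forestBasis_apply, treeDer, Module.Basis.constr_basis]

/-- The factor in `treeDer` is the ratio of `|Aut F|` to `|Aut (F \ T)|` given by `forestAut_cons`.
If `T` does not occur in `F`, both sides are zero. -/
theorem pairing_treeDer (T : Tree) (A B : SPL k) :
    pairing k (treeDer k T A) B = pairing k A (tree k T * B) := by
  suffices h : pairing k ∘ₗ treeDer k T =
      (pairing k).compl₂ (LinearMap.mulLeft k (tree k T)) from LinearMap.congr_fun₂ h A B
  refine forest_ext k fun F => forest_ext k fun G => ?_
  rw [LinearMap.comp_apply, LinearMap.compl₂_apply, LinearMap.mulLeft_apply, ← forest_cons,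
    treeDer_forest, map_smul, LinearMap.smul_apply, pairing_forest, pairing_forest, smul_eq_mul]
  by_cases hT : T ∈ F
  · obtain ⟨F, rfl⟩ := Multiset.exists_cons_of_mem hT
    rw [Multiset.erase_cons_head, Multiset.count_cons_self]
    by_cases h : F = G
    · rw [if_pos h, if_pos (by rw [h]), forestAut_cons]
      push_cast
      ring
    · rw [if_neg h, if_neg (by simpa using h), mul_zero]
  · rw [Multiset.count_eq_zero_of_notMem hT, if_neg (c := F = T ::ₘ G)]
    · simp
    · rintro rfl
      simp at hT

theorem treeDer_one (T : Tree) : treeDer k T 1 = 0 := by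
  rw [← forest_zero, treeDer_forest]
  simp

/-- The Leibniz rule for `|Aut T| ∂/∂T`, needed only against a single tree. -/
theorem treeDer_tree_mul (T S : Tree) (A : SPL k) : treeDer k T (tree k S * A) =
    (if S = T then (T.aut : k) else 0) • A + tree k S * treeDer k T A := by
  suffices h : treeDer k T ∘ₗ LinearMap.mulLeft k (tree k S) =
      (if S = T then (T.aut : k) else 0) • LinearMap.id +
        LinearMap.mulLeft k (tree k S) ∘ₗ treeDer k T from LinearMap.congr_fun h A
  refine forest_ext k fun F => ?_
  simp only [LinearMap.comp_apply, LinearMap.mulLeft_apply, LinearMap.add_apply,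
    LinearMap.smul_apply, LinearMap.id_apply]
  rw [← forest_cons, treeDer_forest, treeDer_forest, mul_smul_comm, ← forest_cons]
  by_cases h : S = T
  · subst h
    rw [Multiset.erase_cons_head, Multiset.count_cons_self, if_pos rfl]
    by_cases hS : S ∈ F
    · rw [Multiset.cons_erase hS, ← add_smul]
      congr 1
      push_cast
      ring
    · simp [Multiset.count_eq_zero_of_notMem hS]
  · rw [if_neg h, zero_smul, zero_add, Multiset.count_cons_of_ne (Ne.symm h),
      Multiset.erase_cons_tail _ h]

/-- A derivation with constant coefficients commutes with translations, and `Δ` is the translation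
`T ↦ T ⊗ 1 + 1 ⊗ T` of the variables. Differentiating in the first group of variables alone is
enough. -/
theorem coproduct_treeDer (T : Tree) (A : SPL k) : coproduct k (PL k) (treeDer k T A) =
    (treeDer k T).rTensor (SPL k) (coproduct k (PL k) A) := by
  induction A using forest_induction k with
  | add a b ha hb => simp only [map_add, ha, hb]
  | smul r a ha => simp only [map_smul, ha]
  | h F =>
    induction F using Multiset.induction_on with
    | empty => simp [forest_zero, treeDer_one, Algebra.TensorProduct.one_def]
    | cons S F ih =>
      rw [forest_cons, treeDer_tree_mul, map_add, map_smul, map_mul, map_mul, ih]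
      rw [show coproduct k (PL k) (tree k S) = _ from coproduct_ι k _]
      generalize coproduct k (PL k) (forest k F) = t
      induction t using TensorProduct.induction_on with
      | zero => simp
      | add s t hs ht =>
        simp only [map_add, mul_add, smul_add] at hs ht ⊢
        rw [← hs, ← ht]
        abel
      | tmul u v =>
        change _ + (tree k S ⊗ₜ[k] 1 + 1 ⊗ₜ[k] tree k S) * _ =
          LinearMap.rTensor (SPL k) (treeDer k T) ((tree k S ⊗ₜ[k] 1 + 1 ⊗ₜ[k] tree k S) * _)
        simp only [add_mul, LinearMap.rTensor_tmul, Algebra.TensorProduct.tmul_mul_tmul, one_mul,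
          map_add, treeDer_tree_mul, TensorProduct.add_tmul, TensorProduct.smul_tmul']
        abel

/-- The trees of `B` are moved one at a time to the left of the pairing as derivations of `A`; by
`coproduct_treeDer` they act on the first factor of `Δ(A)`, the one paired with `B`. -/
theorem pairing_mul (A B C : SPL k) :
    pairing k A (B * C) = pairingTensor k (coproduct k (PL k) A) (B ⊗ₜ[k] C) := by
  induction B using forest_induction k generalizing A with
  | add a b ha hb => simp only [add_mul, map_add, TensorProduct.add_tmul, ha, hb]
  | smul r a ha => simp only [smul_mul_assoc, map_smul, ← TensorProduct.smul_tmul', ha]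
  | h F =>
    induction F using Multiset.induction_on generalizing A with
    | empty =>
      rw [forest_zero, one_mul]
      -- Only the left occurrence is replaced by `(ε ⊗ id) Δ(A)`, so that both sides become linear
      -- in `Δ(A)`; then `⟨u, 1⟩ = ε(u)`.
      nth_rw 1 [← counit_coproduct k (PL k) A]
      generalize coproduct k (PL k) A = t
      induction t using TensorProduct.induction_on with
      | zero => simp
      | add s t hs ht => simp only [map_add, LinearMap.add_apply, hs, ht]
      | tmul u v => simp [pairingTensor_tmul, pairing_one_right]
    | cons T F ih =>
      rw [forest_cons, mul_assoc, ← pairing_treeDer, ih, coproduct_treeDer]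
      generalize coproduct k (PL k) A = t
      induction t using TensorProduct.induction_on with
      | zero => simp
      | add s t hs ht => simp only [map_add, LinearMap.add_apply, hs, ht]
      | tmul u v => 
        rw [LinearMap.rTensor_tmul, pairingTensor_tmul, pairingTensor_tmul, pairing_treeDer]

/-! ### The adjoint of `B₊` and its cocycle equation. -/

/-- The linear map that sends a tree to the forest of its branches. -/
def branches : PL k →ₗ[k] SPL k := (PL.basis k).constr k fun T => forest k T.children

theorem branches_basis (T : Tree) : branches k (PL.basis k T) = forest k T.children := by
  rw [branches, Module.Basis.constr_basis]

/-- The symmetry condition of `exists_linear_rec` holds because `ε(A x) = 0` makes both of its sides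
zero. Unlike a definition on the basis of forests, this form can be applied to `A x` with arbitrary
`A` and `x`, such as those produced by `circRight`. -/
theorem exists_bPlusAdjoint : ∃ R : SPL k →ₗ[k] SPL k, R 1 = 0 ∧
    ∀ A x, R (A * SymmetricAlgebra.ι k (PL k) x) =
      SymmetricAlgebra.algebraMapInv A • branches k x :=
  exists_linear_rec k
    (LinearMap.mk₂ k (fun A x => SymmetricAlgebra.algebraMapInv A • branches k x)
      (by intros; simp [add_smul]) (by intros; simp [mul_smul]) (by intros; simp)
      (by intros; rw [map_smul, smul_comm]))
    (by intros; simp [SymmetricAlgebra.algebraMapInv_ι]) 0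

/-- The adjoint of `B₊`: it sends a tree to the forest of its branches, and vanishes on the forests
that are not trees. -/
def bPlusAdjoint : SPL k →ₗ[k] SPL k := (exists_bPlusAdjoint k).choose

theorem bPlusAdjoint_one : bPlusAdjoint k 1 = 0 := (exists_bPlusAdjoint k).choose_spec.1

theorem bPlusAdjoint_mul_ι (A : SPL k) (x : PL k) :
    bPlusAdjoint k (A * SymmetricAlgebra.ι k (PL k) x) =
      SymmetricAlgebra.algebraMapInv A • branches k x :=
  (exists_bPlusAdjoint k).choose_spec.2 A x

theorem pairing_bPlusAdjoint (A B : SPL k) :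
    pairing k (bPlusAdjoint k A) B = pairing k A (bPlus k B) := by
  suffices h : pairing k ∘ₗ bPlusAdjoint k = (pairing k).compl₂ (bPlus k) from
    LinearMap.congr_fun₂ h A B
  refine forest_ext k fun F => forest_ext k fun G => ?_
  rw [LinearMap.comp_apply, LinearMap.compl₂_apply, bPlus_forest, ← forest_singleton,
    pairing_forest]
  induction F using Multiset.induction_on with
  | empty => simp [forest_zero, bPlusAdjoint_one]
  | cons T F _ =>
    rw [forest_cons, mul_comm, tree, bPlusAdjoint_mul_ι, branches_basis, map_smul,
      LinearMap.smul_apply, pairing_forest, smul_eq_mul]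
    induction F using Multiset.induction_on with
    | empty =>
      rw [forest_zero, map_one, one_mul]
      by_cases h : T.children = G
      · have hT : Tree.node G = T := by rw [← h]; exact Tree.equivForest.symm_apply_apply T
        -- The weights agree because `T` and the forest of its branches have the same number of
        -- automorphisms.
        rw [if_pos h, hT, if_pos (by simp), forestAut_cons, aut_eq]
        simp [forestAut]
      · rw [if_neg h, if_neg]
        intro h'
        refine h ?_
        rw [show T = Tree.node G by simpa using h']
        exact Tree.equivForest.apply_symm_apply G
    | cons S F _ =>
      rw [forest_cons, map_mul, algebraMapInv_tree, zero_mul, zero_mul, if_neg]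
      intro h
      simpa using congrArg Multiset.card h

/-- The induction adds one branch `A` at a time to a tree with branches `F`. Grafting `y` then gives
`(F ⋆ y) A + F (A ∘ y)`, which is `(F A) ⋆ y` by the Leibniz rule. -/
theorem branches_mul (x y : PL k) :
    branches k (x * y) = starRight k (PL k) y (branches k x) := by
  have hadd : ∀ x z : PL k, branches k (PL.addBranch k x z) =
      branches k x * SymmetricAlgebra.ι k (PL k) z := by
    intro x z
    suffices h : (PL.addBranch k).compr₂ (branches k) =
        ((LinearMap.mul k (SPL k)).compl₂ (SymmetricAlgebra.ι k (PL k))) ∘ₗ branches k from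
      LinearMap.congr_fun₂ h x z
    refine (PL.basis k).ext fun T => (PL.basis k).ext fun S => ?_
    rw [LinearMap.compr₂_apply, PL.addBranch_basis, branches_basis, Tree.children_addBranch,
      forest_cons, mul_comm, LinearMap.comp_apply, branches_basis]
    rfl
  induction x using PL.induction_basis k with
  | add a b ha hb => rw [add_mul, map_add, map_add, map_add, ha, hb]
  | smul r a ha => rw [smul_mul_assoc, map_smul, map_smul, map_smul, ha]
  | h T =>
    induction T using Tree.tree_induction with
    | h0 =>
      refine (congrArg (branches k) (PL.preLie_vertex k y)).trans ?_
      rw [hadd, branches_basis, show Tree.vertex.children = 0 from rfl, forest_zero,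
        starRight_apply, circRight_one, add_zero]
    | h T A hT _ =>
      rw [← PL.addBranch_basis]
      refine (congrArg (branches k) (PL.preLie_addBranch k _ _ y)).trans ?_
      rw [map_add, hadd, hadd, hadd]
      change branches k (PL.basis k T * y) * _ +
        _ * SymmetricAlgebra.ι k (PL k) (PL.basis k A * y) = _
      rw [hT, starRight_apply, starRight_apply, circRight_mul, circRight_ι]
      ring

/-- `circRight` preserves the number of trees, so both sides vanish except on the part of `A` in
`PL`, where the claim is `branches_mul`. -/
theorem bPlusAdjoint_circRight (x : PL k) (A : SPL k) :
    bPlusAdjoint k (circRight k (PL k) x A) = starRight k (PL k) x (bPlusAdjoint k A) := by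
  induction A using sym_induction with
  | one => simp [circRight_one, bPlusAdjoint_one]
  | add a b ha hb => simp only [map_add, ha, hb]
  | smul r a ha => simp only [map_smul, ha]
  | mul_ι a y ha =>
    rw [circRight_mul, map_add, bPlusAdjoint_mul_ι, algebraMapInv_circRight, zero_smul, zero_add,
      circRight_ι, bPlusAdjoint_mul_ι, bPlusAdjoint_mul_ι, branches_mul, map_smul]

/-- The adjoint form of the cocycle equation of `B₊`. -/
theorem bPlusAdjoint_star (A B : SPL k) : bPlusAdjoint k (star k (PL k) A B) =
    SymmetricAlgebra.algebraMapInv A • bPlusAdjoint k B +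
      star k (PL k) (bPlusAdjoint k A) B := by
  induction B using star_induction with
  | one => simp [star_one, bPlusAdjoint_one]
  | add a b ha hb => simp only [map_add, smul_add, ha, hb]; abel
  | smul r a ha => simp only [map_smul, smul_add, ha, smul_comm r]
  | starRight B x hB =>
    -- This is the case `B = x` of the claim. It is used twice, for `C = A ⋆ B` and for `C = B`, and
    -- the two instances match because `ε(A ⋆ B) = ε(A) ε(B)`.
    have h : ∀ C, bPlusAdjoint k (starRight k (PL k) x C) =
        SymmetricAlgebra.algebraMapInv C • branches k x +
          starRight k (PL k) x (bPlusAdjoint k C) := by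
      intro C
      rw [starRight_apply, map_add, bPlusAdjoint_mul_ι, bPlusAdjoint_circRight]
    rw [star_starRight, h, h, hB, star_starRight, algebraMapInv_star, map_add, map_smul, smul_add,
      mul_smul, add_assoc]

/-! ### Duality of `⋆` and the opposite Connes-Kreimer coproduct. -/

/-- For `s` in the tensor square, the bilinear form `(A, B) ↦ ⟨A ⊗ B, s⟩`. -/
def pairingWith : SPL k ⊗[k] SPL k →ₗ[k] LinearMap.BilinForm k (SPL k) :=
  TensorProduct.lcurry (RingHom.id k) (SPL k) (SPL k) k ∘ₗ (pairingTensor k).flip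

theorem pairingWith_apply (s : SPL k ⊗[k] SPL k) (A B : SPL k) :
    pairingWith k s A B = pairingTensor k (A ⊗ₜ[k] B) s := rfl

/-- The version of `pairing_mul` for the tensor square. Viewing `s` and `t` as bilinear forms lets
`LinearMap.BilinForm.tmul` pair the first factors of `Δ(A)` and `Δ(B)` with `s` and the second ones
with `t`, without an explicit exchange of the middle factors. -/
theorem pairingTensor_mul (A B : SPL k) (s t : SPL k ⊗[k] SPL k) :
    pairingTensor k (A ⊗ₜ[k] B) (s * t) =
      LinearMap.BilinForm.tmul (pairingWith k s) (pairingWith k t)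
        (coproduct k (PL k) A) (coproduct k (PL k) B) := by
  induction s using TensorProduct.induction_on with
  | zero => simp [LinearMap.BilinForm.tmul]
  | add s s' hs hs' =>
    simp only [add_mul, map_add, hs, hs', LinearMap.BilinForm.tmul, TensorProduct.add_tmul,
      LinearMap.add_apply]
  | tmul s₁ s₂ =>
    induction t using TensorProduct.induction_on with
    | zero => simp [LinearMap.BilinForm.tmul]
    | add t t' ht ht' =>
      simp only [mul_add, map_add, ht, ht', LinearMap.BilinForm.tmul, TensorProduct.tmul_add,
        LinearMap.add_apply]
    | tmul t₁ t₂ =>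
      rw [Algebra.TensorProduct.tmul_mul_tmul, pairingTensor_tmul, pairing_mul, pairing_mul]
      generalize coproduct k (PL k) A = a
      generalize coproduct k (PL k) B = b
      induction a using TensorProduct.induction_on with
      | zero => simp
      | add a a' ha ha' => simp only [map_add, LinearMap.add_apply, add_mul, ha, ha']
      | tmul a₁ a₂ =>
        induction b using TensorProduct.induction_on with
        | zero => simp
        | add b b' hb hb' => simp only [map_add, LinearMap.add_apply, mul_add, hb, hb']
        | tmul b₁ b₂ =>
          rw [LinearMap.BilinForm.tensorDistrib_tmul]
          simp only [pairingTensor_tmul, pairingWith_apply, smul_eq_mul]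
          ring

theorem connesKreimerOp_one : connesKreimerOp k 1 = 1 :=
  map_one ((Algebra.TensorProduct.comm k (SPL k) (SPL k)).toAlgHom.comp (connesKreimer k))

theorem connesKreimerOp_mul (A B : SPL k) :
    connesKreimerOp k (A * B) = connesKreimerOp k A * connesKreimerOp k B :=
  map_mul ((Algebra.TensorProduct.comm k (SPL k) (SPL k)).toAlgHom.comp (connesKreimer k)) A B

theorem connesKreimerOp_bPlus (A : SPL k) : connesKreimerOp k (bPlus k A) =
    1 ⊗ₜ[k] bPlus k A + (bPlus k).rTensor (SPL k) (connesKreimerOp k A) := by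
  simp only [connesKreimerOp, LinearMap.comp_apply, AlgHom.toLinearMap_apply,
    connesKreimer_bPlus, map_add, LinearEquiv.coe_coe, TensorProduct.comm_tmul]
  congr 1
  generalize connesKreimer k A = t
  induction t using TensorProduct.induction_on with
  | zero => simp
  | add s t hs ht => simp only [map_add, hs, ht]
  | tmul u v => simp

/-- The product `⋆` is dual to the opposite of the Connes-Kreimer coproduct. -/
theorem pairing_star (A B C : SPL k) :
    pairing k (star k (PL k) A B) C = pairingTensor k (A ⊗ₜ[k] B) (connesKreimerOp k C) := by
  induction C using bPlus_induction k generalizing A B with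
  | one =>
    rw [pairing_one_right, algebraMapInv_star, connesKreimerOp_one,
      Algebra.TensorProduct.one_def, pairingTensor_tmul, pairing_one_right, pairing_one_right]
  | add a b ha hb => simp only [map_add, ha, hb]
  | smul r a ha => simp only [map_smul, ha]
  -- On terms `a₁ ⊗ a₂` of `Δ(A)` and `b₁ ⊗ b₂` of `Δ(B)`, both sides are `⟨a₁ ⋆ b₁, C⟩ ⟨a₂ ⋆ b₂,
  -- C'⟩`.
  | mul C C' hC hC' =>
    rw [pairing_mul, coproduct_star, connesKreimerOp_mul, pairingTensor_mul]
    generalize coproduct k (PL k) A = a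
    generalize coproduct k (PL k) B = b
    induction a using TensorProduct.induction_on with
    | zero => simp
    | add a a' ha ha' => simp only [map_add, LinearMap.add_apply, ha, ha']
    | tmul a₁ a₂ =>
      induction b using TensorProduct.induction_on with
      | zero => simp
      | add b b' hb hb' => simp only [map_add, LinearMap.add_apply, hb, hb']
      | tmul b₁ b₂ =>
        rw [LinearMap.BilinForm.tensorDistrib_tmul, TensorProduct.map₂_apply_tmul,
          TensorProduct.map_tmul, pairingTensor_tmul, hC, hC', pairingWith_apply, pairingWith_apply,
          smul_eq_mul, mul_comm]
  | bPlus C hC =>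
    -- The two terms of `R(A ⋆ B)` match those of `Δ_CK^op(B₊ C)`: `ε(A) R(B)` gives `1 ⊗ B₊ C`, and
    -- `R(A) ⋆ B` gives `(B₊ ⊗ id) Δ_CK^op(C)`. The hypothesis `hC` is applied to `R(A)` in place of
    -- `A`, hence the generalization.
    rw [← pairing_bPlusAdjoint, bPlusAdjoint_star, map_add, map_smul, LinearMap.add_apply,
      LinearMap.smul_apply, pairing_bPlusAdjoint, hC, connesKreimerOp_bPlus, map_add,
      pairingTensor_tmul, pairing_one_right, smul_eq_mul]
    congr 1
    generalize connesKreimerOp k C = t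
    induction t using TensorProduct.induction_on with
    | zero => simp
    | add s t hs ht => simp only [map_add, hs, ht]
    | tmul u v =>
      rw [LinearMap.rTensor_tmul, pairingTensor_tmul, pairingTensor_tmul, pairing_bPlusAdjoint]

/-- The pairing is diagonal on forests, so the remaining claims reduce to cancelling or dividing by
`|Aut F|` in `k`. -/
theorem pairing_forest_right (A : SPL k) (F : Multiset Tree) :
    pairing k A (forest k F) = (forestBasis k).repr A F * forestAut F := by
  induction A using forest_induction k with
  | add a b ha hb => simp only [map_add, LinearMap.add_apply, ha, hb, Finsupp.add_apply, add_mul]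
  | smul r a ha =>
    simp only [map_smul, LinearMap.smul_apply, ha, Finsupp.smul_apply, smul_eq_mul, mul_assoc]
  | h G =>
    rw [pairing_forest, ← forestBasis_apply, Module.Basis.repr_self, Finsupp.single_apply]
    by_cases h : G = F
    · rw [if_pos h, if_pos h, one_mul, h]
    · rw [if_neg h, if_neg h, zero_mul]

end Duality

/-! ### Positivity of the automorphism numbers, and finiteness for a bounded number of vertices. -/

namespace Tree

theorem numVertices_addBranch (T S : Tree) :
    (addBranch T S).numVertices = T.numVertices + S.numVertices := by
  obtain ⟨t, rfl⟩ := exists_mk T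
  obtain ⟨s, rfl⟩ := exists_mk S
  exact Fintype.card_sum (α := t.Vert) (β := s.Vert)

theorem numVertices_pos (T : Tree) : 0 < T.numVertices := by
  induction T using tree_induction with
  | h0 => exact Nat.one_pos
  | h T S hT _ => rw [numVertices_addBranch]; omega

theorem aut_pos (T : Tree) : 0 < T.aut := by
  induction T using tree_induction with
  | h0 => exact Nat.one_pos
  | h T S hT hS => rw [aut_addBranch]; positivity

theorem finite_numVertices_le (n : ℕ) : {T : Tree | T.numVertices ≤ n}.Finite := by
  induction n with
  | zero =>
    refine Set.finite_empty.subset fun T hT => ?_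
    have := T.numVertices_pos
    simp only [Set.mem_ofPred_eq] at hT
    omega
  | succ n ih =>
    -- A tree other than the single vertex splits as `addBranch T S`. Each part has at least one
    -- vertex, so the other has at most `n`.
    refine ((Set.finite_singleton vertex).union (ih.image2 addBranch ih)).subset fun T hT => ?_
    induction T using tree_induction with
    | h0 => exact Or.inl rfl
    | h T S _ _ =>
      have h1 := T.numVertices_pos
      have h2 := S.numVertices_pos
      simp only [Set.mem_ofPred_eq, numVertices_addBranch] at hT
      refine Or.inr ⟨T, ?_, S, ?_, rfl⟩ <;> simp only [Set.mem_ofPred_eq] <;> omega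

theorem numVertices_node (F : Multiset Tree) :
    (node F).numVertices = forestVertices F + 1 := by
  induction F using Multiset.induction_on with
  | empty => rfl
  | cons T F ih =>
    rw [node_cons, numVertices_addBranch, ih, forestVertices, forestVertices, Multiset.map_cons,
      Multiset.sum_cons]
    ring

end Tree

theorem forestAut_ne_zero (F : Multiset Tree) : forestAut F ≠ 0 := by
  have h := (Tree.node F).aut_pos
  rw [aut_eq, show (Tree.node F).children = F from Tree.equivForest.apply_symm_apply F] at h
  exact h.ne'

/-- `B₊` embeds these forests into the trees with at most `n + 1` vertices, the extra one being the
new root. -/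
theorem finite_forestVertices_le (n : ℕ) : {F : Multiset Tree | forestVertices F ≤ n}.Finite := by
  refine ((Tree.finite_numVertices_le (n + 1)).preimage
    (Tree.equivForest.symm.injective.injOn)).subset fun F hF => ?_
  change (Tree.node F).numVertices ≤ n + 1
  rw [Tree.numVertices_node]
  exact Nat.succ_le_succ hF

/-! ### Nondegeneracy and the graded dual. -/

section Duality

variable (k : Type*) [CommRing k]

theorem pairing_nondegenerate [IsAddTorsionFree k] : (pairing k).Nondegenerate := by
  have h : (pairing k).SeparatingLeft := by
    intro A hA
    refine (forestBasis k).repr.map_eq_zero_iff.mp (Finsupp.ext fun F => ?_)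
    have hF := hA (forest k F)
    rw [pairing_forest_right, mul_comm, ← nsmul_eq_mul] at hF
    refine IsAddTorsionFree.nsmul_right_injective (forestAut_ne_zero F) ?_
    simpa using hF
  exact ⟨h, fun B hB => h B fun A => by rw [pairing_comm, hB A]⟩

theorem pairing_injective (hk : ∀ n : ℕ, n ≠ 0 → IsUnit (n : k)) :
    Function.Injective (pairing k) := by
  intro A B h
  refine (forestBasis k).repr.injective (Finsupp.ext fun F => ?_)
  have hF := LinearMap.congr_fun h (forest k F)
  rw [pairing_forest_right, pairing_forest_right] at hF
  exact (hk _ (forestAut_ne_zero F)).mul_right_cancel hF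

theorem exists_pairing_eq_iff (hk : ∀ n : ℕ, n ≠ 0 → IsUnit (n : k)) (φ : SPL k →ₗ[k] k) :
    (∃ A, pairing k A = φ) ↔
      ∃ N : ℕ, ∀ F : Multiset Tree, N < forestVertices F → φ (forest k F) = 0 := by
  constructor
  · rintro ⟨A, rfl⟩
    -- The bound is the largest number of vertices of a forest that occurs in `A`.
    refine ⟨((forestBasis k).repr A).support.sup forestVertices, fun F hF => ?_⟩
    rw [pairing_forest_right]
    by_cases h : F ∈ ((forestBasis k).repr A).support
    · exact absurd (Finset.le_sup (f := forestVertices) h) (not_le.mpr hF)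
    · rw [Finsupp.notMem_support_iff.mp h, zero_mul]
  · rintro ⟨N, hN⟩
    -- The coefficient of `F` in `A` must be `φ(F) / |Aut F|`. `Ring.inverse` is a true inverse
    -- here, since `hk` makes `|Aut F|` a unit, and the support is finite because `φ` vanishes
    -- beyond `N` vertices.
    refine ⟨(forestBasis k).repr.symm (Finsupp.onFinset (finite_forestVertices_le N).toFinset
      (fun F => φ (forest k F) * Ring.inverse (forestAut F : k)) fun F hF => ?_), ?_⟩
    · rw [Set.Finite.mem_toFinset]
      refine not_lt.mp fun h : N < forestVertices F => hF ?_
      rw [hN F h, zero_mul]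
    · refine forest_ext k fun F => ?_
      rw [pairing_forest_right, LinearEquiv.apply_symm_apply, Finsupp.onFinset_apply, mul_assoc,
        Ring.inverse_mul_cancel _ (hk _ (forestAut_ne_zero F)), mul_one]

end Duality

end PreLieSym

end

theorem proposition3p2 (k : Type*) [CommRing k] :
    -- the product of the pre-Lie construction is dual to the opposite Connes-Kreimer coproduct
    (∀ A B C : PreLieSym.SPL k,
      PreLieSym.pairing k (PreLieSym.starProduct k (PreLieSym.PL k) A B) C =
        PreLieSym.pairingTensor k (A ⊗ₜ[k] B) (PreLieSym.connesKreimerOp k C)) ∧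
    -- the coproduct with primitive trees is dual to the polynomial product
    (∀ A B C : PreLieSym.SPL k,
      PreLieSym.pairing k A (B * C) =
        PreLieSym.pairingTensor k (PreLieSym.coproduct k (PreLieSym.PL k) A) (B ⊗ₜ[k] C)) ∧
    -- the pairing is non degenerate on both sides over torsion free rings
    (IsAddTorsionFree k → (PreLieSym.pairing k).Nondegenerate) ∧
    -- over algebras over the rationals it identifies the algebra with the graded dual
    ((∀ n : ℕ, n ≠ 0 → IsUnit (n : k)) →
      ∀ φ : PreLieSym.SPL k →ₗ[k] k,
        (∃ N : ℕ, ∀ F : Multiset PreLieSym.Tree, N < PreLieSym.forestVertices F →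
          φ (PreLieSym.forest k F) = 0) ↔
        ∃! A : PreLieSym.SPL k, PreLieSym.pairing k A = φ) := by
  refine ⟨PreLieSym.pairing_star k, PreLieSym.pairing_mul k,
    fun _ => PreLieSym.pairing_nondegenerate k, fun hk φ => ?_⟩
  rw [← PreLieSym.exists_pairing_eq_iff k hk φ]
  exact ⟨fun ⟨A, hA⟩ => ⟨A, hA, fun B hB => PreLieSym.pairing_injective k hk (hB.trans hA.symm)⟩,
    fun ⟨A, hA, _⟩ => ⟨A, hA⟩⟩
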